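/- For integers $d\ge 2$, $n\ge 0$ let $C_d(n)=\Big[\prod_{p=0}^{d-1}\frac{p!}{(n+p)!}\Big](dn)!$ be the $d$-dimensional Catalan numbers. A weight for $C_d$ is a pair $(R,W)$ where $W$ is a real function that is continuous on $(0,R]$, whose support in $(0,R]$ has upper edge $R$ (that is, $R$ is the least upper bound of the points of $(0,R]$ at which $W\neq 0$), for which $x^nW(x)$ is integrable on $(0,R]$ for every $n\ge 0$, and which solves the Hausdorff moment problem $$\int_0^{R}x^nW(x)\,dx=C_d(n),\qquad n=0,1,2,\ldots$$ Write $(a)_k=a(a+1)\cdots(a+k-1)$ and $${}_pF_q\left({a_1,\ldots,a_p\atop b_1,\ldots,b_q}\Big|z\right)=\sum_{k\ge0}\frac{(a_1)_k\cdots(a_p)_k}{(b_1)_k\cdots(b_q)_k}\frac{z^k}{k!}.$$ For every $d\ge 2$ there is a weight for $C_d$ with $R=d^d$ that is positive on $(0,d^d)$. Every weight $(R,W)$ for $C_d$ has $R=d^d$, and $W=W_d$ on $(0,d^d]$, where for $0<x\le d^d$ $$W_d(x)=\sum_{j=1}^{d-1}\frac{c_j(d)}{x^{j/d}}\;{}_{d-1}F_{d-2}\left({-\frac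 jd,\,-1-\frac jd,\,\ldots,\,-d+2-\frac jd\atop 1-\frac1d,\ldots,1-\frac{j-1}d\,;\;1+\frac1d,\ldots,1+\frac{d-j-1}d}\Big|\frac{x}{d^d}\right),$$ $$c_j(d)=(2\pi)^{\frac{1-d}2}\,d^{\,j-d+\frac12}\left[\prod_{p=1}^{d-1}\frac{p!}{\Gamma(p+\frac jd)}\right]\left[\prod_{k=1}^{j-1}\Gamma\Big(\frac kd\Big)\right]\left[\prod_{k=j+1}^{d-1}\Gamma\Big(\frac{j-k}d\Big)\right],$$ and all the hypergeometric series here converge (also at $x=d^d$). The lower list consists of two sequences, with $j-1$ and $d-1-j$ terms; empty products are $1$. In particular $$W_2(x)=\frac1{2\pi}\sqrt{\frac{4-x}x},\qquad 0<x\le4,$$ $$W_3(x)=\frac{c_1(3)}{x^{1/3}}\,{}_2F_1\left({-\frac43,-\frac13\atop\frac43}\Big|\frac x{3^3}\right)+\frac{c_2(3)}{x^{2/3}}\,{}_2F_1\left({-\frac53,-\frac23\atop\frac23}\Big|\frac x{3^3}\right),\qquad 0<x\le 3^3,$$ $$W_4(x)=\frac{c_1(4)}{x^{1/4}}\,{}_3F_2\left({-\frac94,-\frac54,-\frac14\atop\frac54,\frac32}\Big|\frac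 x{4^4}\right)+\frac{c_2(4)}{x^{1/2}}\,{}_3F_2\left({-\frac52,-\frac32,-\frac12\atop\frac34,\frac54}\Big|\frac x{4^4}\right)+\frac{c_3(4)}{x^{3/4}}\,{}_3F_2\left({-\frac{11}4,-\frac74,-\frac34\atop\frac12,\frac34}\Big|\frac x{4^4}\right),\qquad 0<x\le 4^4,$$ and, for $0<x\le 5^5$, $$W_5(x)=\frac{c_1(5)}{x^{1/5}}\,{}_4F_3\left({-\frac{16}5,-\frac{11}5,-\frac65,-\frac15\atop\frac65,\frac75,\frac85}\Big|\frac x{5^5}\right)+\frac{c_2(5)}{x^{2/5}}\,{}_4F_3\left({-\frac{17}5,-\frac{12}5,-\frac75,-\frac25\atop\frac45,\frac65,\frac75}\Big|\frac x{5^5}\right)$$ $$\qquad+\frac{c_3(5)}{x^{3/5}}\,{}_4F_3\left({-\frac{18}5,-\frac{13}5,-\frac85,-\frac35\atop\frac35,\frac45,\frac65}\Big|\frac x{5^5}\right)+\frac{c_4(5)}{x^{4/5}}\,{}_4F_3\left({-\frac{19}5,-\frac{14}5,-\frac95,-\frac45\atop\frac25,\frac35,\frac45}\Big|\frac x{5^5}\right).$$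 -/

import Mathlib

open scoped Nat

noncomputable section

/-- The `d`-dimensional Catalan number
`C_d(n) = [∏_{p=0}^{d-1} p! / (n+p)!] (d n)!`, as a real number. -/
def catalanDim (d n : ℕ) : ℝ :=
  (∏ p ∈ Finset.range d, (p ! : ℝ) / ((n + p)! : ℝ)) * ((d * n)! : ℝ)

/-- `W` is a weight on `(0, R]` for the numbers `C_d(n)`: it is continuous on `(0, R]`, `R` is the
upper edge of its support, and its power moments exist and solve the Hausdorff moment problem
`∫_0^R x^n W(x) dx = C_d(n)` for all `n ≥ 0`. Values of `W` outside `(0, R]` play no role. -/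
structure IsCatalanWeight (d : ℕ) (R : ℝ) (W : ℝ → ℝ) : Prop where
  continuousOn : ContinuousOn W (Set.Ioc 0 R)
  isLUB_support : IsLUB {x : ℝ | x ∈ Set.Ioc 0 R ∧ W x ≠ 0} R
  integrableOn (n : ℕ) : MeasureTheory.IntegrableOn (fun x : ℝ => x ^ n * W x) (Set.Ioc 0 R)
  moment (n : ℕ) : ∫ x in Set.Ioc 0 R, x ^ n * W x = catalanDim d n

/-- The `k`-th term `(a_1)_k ⋯ (a_p)_k / ((b_1)_k ⋯ (b_q)_k) * z^k / k!` of the generalized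
hypergeometric series, where `(a)_k = a (a+1) ⋯ (a+k-1)`. -/
def hypTerm (a b : Multiset ℝ) (z : ℝ) (k : ℕ) : ℝ :=
  (a.map fun u => (ascPochhammer ℝ k).eval u).prod /
    (b.map fun u => (ascPochhammer ℝ k).eval u).prod * (z ^ k / (k ! : ℝ))

/-- The generalized hypergeometric function `_pF_q(a; b | z)` (real parameters and argument),
as the sum of its series. -/
def hypPFQ (a b : Multiset ℝ) (z : ℝ) : ℝ :=
  ∑' k : ℕ, hypTerm a b z k

/-- The `d - 1` upper parameters `-j/d, -1 - j/d, …, -(d-2) - j/d`. -/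
def upperParams (d j : ℕ) : Multiset ℝ :=
  (Multiset.range (d - 1)).map fun i => -(i : ℝ) - (j : ℝ) / (d : ℝ)

/-- The `d - 2` lower parameters
`1 - 1/d, …, 1 - (j-1)/d; 1 + 1/d, …, 1 + (d-j-1)/d`. -/
def lowerParams (d j : ℕ) : Multiset ℝ :=
  ((Multiset.range (j - 1)).map fun i => 1 - ((i : ℝ) + 1) / (d : ℝ)) +
    ((Multiset.range (d - j - 1)).map fun i => 1 + ((i : ℝ) + 1) / (d : ℝ))

/-- The coefficient
`c_j(d) = (2π)^{(1-d)/2} d^{j-d+1/2} [∏_{p=1}^{d-1} p!/Γ(p+j/d)] [∏_{k=1}^{j-1} Γ(k/d)]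
  [∏_{k=j+1}^{d-1} Γ((j-k)/d)]`. -/
def weightCoeff (d j : ℕ) : ℝ :=
  (2 * Real.pi) ^ ((1 - (d : ℝ)) / 2) * (d : ℝ) ^ ((j : ℝ) - (d : ℝ) + 1 / 2) *
    (∏ p ∈ Finset.Ico 1 d, (p ! : ℝ) / Real.Gamma ((p : ℝ) + (j : ℝ) / (d : ℝ))) *
    (∏ k ∈ Finset.Ico 1 j, Real.Gamma ((k : ℝ) / (d : ℝ))) *
    (∏ k ∈ Finset.Ico (j + 1) d, Real.Gamma (((j : ℝ) - (k : ℝ)) / (d : ℝ)))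

end

/-!
By Gauss's multiplication formula `C_d(n)` is a constant times
`(d ^ d) ^ (n + 1) * ∏_{j=1}^{d-1} Γ(n + 1 - j/d) / Γ(n + 1 + j)`. Each factor is the `n`-th moment
of a beta density on `(0, 1)`, and the moments of a multiplicative convolution are the products of
the moments. This gives a continuous weight that is positive on `(0, d ^ d)`.

On the other hand, the partial fraction expansion of the Gamma product in `n` has simple poles at
`-(i + 1 - j/d)`, and `1 / (n + i + 1 - j/d)` is the `n`-th moment of `t ^ (i - j/d)` on `(0, 1)`.
The residues at the poles are, up to a constant, the coefficients of the hypergeometric series, so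
the sum of these series has the same moments. Finally, by Weierstrass, the moments determine both
the upper edge of the support and the values of a continuous weight.
-/

/-! ### The binomial series of `(1 - x) ^ (c - 1) / Γ(c)` -/

section BinomialSeries

open Set

/-- The coefficients of the binomial series of `(1 - x) ^ (c - 1) / Γ(c)`. They are also the
residues of `Γ(t) / Γ(t + c)` at the poles `t = -k`. -/
noncomputable def betaCoeff (c : ℝ) (k : ℕ) : ℝ :=
  (ascPochhammer ℝ k).eval (1 - c) / (k ! : ℝ) / Real.Gamma c

lemma betaCoeff_succ (c : ℝ) (k : ℕ) :
    ((k : ℝ) + 1) * betaCoeff c (k + 1) = ((k : ℝ) + 1 - c) * betaCoeff c k := by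
  have hf : (k ! : ℝ) ≠ 0 := by positivity
  simp only [betaCoeff, ascPochhammer_succ_eval, Nat.factorial_succ, Nat.cast_mul, Nat.cast_add,
    Nat.cast_one, div_eq_mul_inv, mul_inv]
  field_simp
  ring

lemma sub_one_mul_abs_betaCoeff {c : ℝ} {k : ℕ} (hk : c ≤ k) :
    (c - 1) * |betaCoeff c k| = k * |betaCoeff c k| - (k + 1 : ℕ) * |betaCoeff c (k + 1)| := by
  have h := congrArg abs (betaCoeff_succ c k)
  rw [abs_mul, abs_mul, abs_of_nonneg (by positivity : (0 : ℝ) ≤ (k : ℝ) + 1),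
    abs_of_nonneg (by linarith : (0 : ℝ) ≤ (k : ℝ) + 1 - c)] at h
  push_cast
  linarith

lemma summable_betaCoeff {c : ℝ} (hc : 1 < c) : Summable (betaCoeff c) := by
  obtain ⟨K, hK⟩ := exists_nat_gt c
  have telescope (N : ℕ) : (c - 1) * ∑ i ∈ Finset.range N, |betaCoeff c (i + K)| =
      K * |betaCoeff c K| - (N + K : ℕ) * |betaCoeff c (N + K)| := by
    have hcK (i : ℕ) : c ≤ (i + K : ℕ) := hK.le.trans (by exact_mod_cast Nat.le_add_left K i)
    simp only [Finset.mul_sum, sub_one_mul_abs_betaCoeff (hcK _)]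
    have := Finset.sum_range_sub' (fun i => ((i + K : ℕ) : ℝ) * |betaCoeff c (i + K)|) N
    simpa only [add_right_comm, zero_add] using this
  rw [← summable_nat_add_iff K]
  refine Summable.of_norm (summable_of_sum_range_le (c := K * |betaCoeff c K| / (c - 1))
    (fun _ => norm_nonneg _) fun N => ?_)
  rw [le_div_iff₀ (sub_pos.2 hc), mul_comm]
  exact (telescope N).trans_le (sub_le_self _ (by positivity))

lemma norm_mul_pow_le (r : ℝ) {x : ℝ} (hx : x ∈ Icc 0 1) (i : ℕ) : ‖r * x ^ i‖ ≤ ‖r‖ := by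
  rw [norm_mul, norm_pow, Real.norm_of_nonneg hx.1]
  exact mul_le_of_le_one_right (norm_nonneg _) (pow_le_one₀ hx.1 hx.2)

lemma summable_mul_pow {r : ℕ → ℝ} (hr : Summable r) {x : ℝ} (hx : x ∈ Icc 0 1) :
    Summable fun i => r i * x ^ i :=
  .of_norm_bounded hr.norm fun i => norm_mul_pow_le (r i) hx i

lemma continuousOn_tsum_mul_pow {r : ℕ → ℝ} (hr : Summable r) :
    ContinuousOn (fun x : ℝ => ∑' i, r i * x ^ i) (Icc 0 1) :=
  continuousOn_tsum (fun i => by fun_prop) hr.norm fun i _ hx => norm_mul_pow_le (r i) hx i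

lemma betaCoeff_eq_choose (c : ℝ) (k : ℕ) :
    betaCoeff c k = Ring.choose (c - 1) k * (-1) ^ k / Real.Gamma c := by
  rw [betaCoeff, Ring.choose_eq_smul, Polynomial.descPochhammer_smeval_eq_ascPochhammer,
    Polynomial.ascPochhammer_smeval_cast, Polynomial.ascPochhammer_smeval_eq_eval,
    ← neg_sub c 1, ascPochhammer_eval_neg_eq_descPochhammer,
    descPochhammer_eval_eq_ascPochhammer, smul_eq_mul]
  ring

lemma hasSum_betaCoeff_mul_pow_of_lt_one (c : ℝ) {x : ℝ} (hx : x ∈ Ico 0 1) :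
    HasSum (fun k => betaCoeff c k * x ^ k) ((1 - x) ^ (c - 1) / Real.Gamma c) := by
  have h := (Real.one_add_rpow_hasFPowerSeriesOnBall_zero (a := c - 1)).hasSum (y := -x)
    (by simpa [Real.enorm_eq_ofReal_abs, abs_of_nonneg hx.1] using hx.2)
  simp only [binomialSeries_apply, List.ofFn_const, List.prod_replicate, smul_eq_mul, zero_sub,
    ← sub_eq_add_neg] at h
  refine (h.div_const (Real.Gamma c)).congr_fun fun k => ?_
  rw [betaCoeff_eq_choose, neg_pow]
  ring

lemma tsum_betaCoeff_mul_pow {c : ℝ} (hc : 1 < c) {x : ℝ} (hx : x ∈ Icc 0 1) :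
    ∑' k, betaCoeff c k * x ^ k = (1 - x) ^ (c - 1) / Real.Gamma c := by
  have hcont : Continuous fun x : ℝ => (1 - x) ^ (c - 1) / Real.Gamma c :=
    ((continuous_const.sub continuous_id).rpow_const fun _ => Or.inr (by linarith)).div_const _
  refine EqOn.of_subset_closure
    (fun y hy => (hasSum_betaCoeff_mul_pow_of_lt_one c hy).tsum_eq)
    (continuousOn_tsum_mul_pow (summable_betaCoeff hc)) hcont.continuousOn Ico_subset_Icc_self ?_ hx
  rw [closure_Ico zero_ne_one]

end BinomialSeries

/-! ### Partial fraction series -/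

section PartialFractions

variable {𝕜 ι κ : Type*} [NormedField 𝕜]

lemma norm_div_le_norm_mul_inv {r p : 𝕜} {δ : ℝ} (hδ : 0 < δ) (hp : δ ≤ ‖p‖) :
    ‖r / p‖ ≤ ‖r‖ * δ⁻¹ := by
  rw [norm_div, div_eq_mul_inv]
  gcongr

lemma norm_tsum_div_le {r p : ι → 𝕜} (hr : Summable fun i => ‖r i‖) {δ : ℝ} (hδ : 0 < δ)
    (hp : ∀ i, δ ≤ ‖p i‖) : ‖∑' i, r i / p i‖ ≤ (∑' i, ‖r i‖) * δ⁻¹ := by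
  rw [← tsum_mul_right]
  exact tsum_of_norm_bounded (hr.mul_right δ⁻¹).hasSum fun i => norm_div_le_norm_mul_inv hδ (hp i)

lemma summable_norm_div_of_le {r p : ι → 𝕜} (hr : Summable fun i => ‖r i‖) {δ : ℝ} (hδ : 0 < δ)
    (hp : ∀ i, δ ≤ ‖p i‖) : Summable fun i => ‖r i / p i‖ :=
  .of_nonneg_of_le (fun _ => norm_nonneg _) (fun i => norm_div_le_norm_mul_inv hδ (hp i))
    (hr.mul_right δ⁻¹)

lemma div_mul_div_eq_partialFractions (r u : 𝕜) {s p q : 𝕜} (hp : s + p ≠ 0) (hq : s + q ≠ 0)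
    (hpq : q - p ≠ 0) :
    r / (s + p) * (u / (s + q)) = r / (s + p) * u / (q - p) + r * (u / (s + q)) / (p - q) := by
  rw [← neg_sub q p, div_neg]
  field_simp
  ring

variable [CompleteSpace 𝕜]

lemma summable_div_of_le {r p : ι → 𝕜} (hr : Summable fun i => ‖r i‖) {δ : ℝ} (hδ : 0 < δ)
    (hp : ∀ i, δ ≤ ‖p i‖) : Summable fun i => r i / p i :=
  (summable_norm_div_of_le hr hδ hp).of_norm

lemma summable_mul_tsum_div_of_le {r p : ι → 𝕜} {u q : κ → 𝕜} (hr : Summable fun i => ‖r i‖)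
    (hu : Summable fun k => ‖u k‖) {η : ℝ} (hη : 0 < η) (hpq : ∀ i k, η ≤ ‖q k - p i‖) :
    Summable fun i => r i * ∑' k, u k / (-p i + q k) := by
  refine .of_norm_bounded (hr.mul_right ((∑' k, ‖u k‖) * η⁻¹)) fun i => ?_
  rw [norm_mul]
  gcongr
  exact norm_tsum_div_le hu hη fun k => (hpq i k).trans_eq (by rw [neg_add_eq_sub])

/-- The inner sums are the values of one factor at the poles of the other. -/
lemma tsum_div_mul_tsum_div {r p : ι → 𝕜} {u q : κ → 𝕜} (hr : Summable fun i => ‖r i‖)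
    (hu : Summable fun k => ‖u k‖) {s : 𝕜} {δ ε η : ℝ} (hδ : 0 < δ) (hε : 0 < ε) (hη : 0 < η)
    (hp : ∀ i, δ ≤ ‖s + p i‖) (hq : ∀ k, ε ≤ ‖s + q k‖) (hpq : ∀ i k, η ≤ ‖q k - p i‖) :
    (∑' i, r i / (s + p i)) * (∑' k, u k / (s + q k)) =
      ∑' i, r i * (∑' k, u k / (-p i + q k)) / (s + p i) +
        ∑' k, u k * (∑' i, r i / (-q k + p i)) / (s + q k) := by
  have hrp := summable_norm_div_of_le hr hδ hp
  have huq := summable_norm_div_of_le hu hε hq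
  have hqp (x : ι × κ) : η ≤ ‖p x.1 - q x.2‖ := (hpq x.1 x.2).trans_eq (norm_sub_rev _ _)
  have split (x : ι × κ) : r x.1 / (s + p x.1) * (u x.2 / (s + q x.2)) =
      r x.1 / (s + p x.1) * u x.2 / (q x.2 - p x.1) +
        r x.1 * (u x.2 / (s + q x.2)) / (p x.1 - q x.2) :=
    div_mul_div_eq_partialFractions _ _ (norm_pos_iff.1 (hδ.trans_le (hp x.1)))
      (norm_pos_iff.1 (hε.trans_le (hq x.2))) (norm_pos_iff.1 (hη.trans_le (hpq x.1 x.2)))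
  have hmul₁ : Summable fun x : ι × κ => ‖r x.1 / (s + p x.1) * u x.2‖ :=
    Summable.mul_norm (f := fun i => r i / (s + p i)) (g := u) hrp hu
  have hmul₂ : Summable fun x : ι × κ => ‖r x.1 * (u x.2 / (s + q x.2))‖ :=
    Summable.mul_norm (f := r) (g := fun k => u k / (s + q k)) hr huq
  have hsum₁ : Summable fun x : ι × κ => r x.1 / (s + p x.1) * u x.2 / (q x.2 - p x.1) :=
    summable_div_of_le hmul₁ hη fun x => hpq x.1 x.2
  have hsum₂ : Summable fun x : ι × κ => r x.1 * (u x.2 / (s + q x.2)) / (p x.1 - q x.2) :=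
    summable_div_of_le hmul₂ hη hqp
  have hcomm : Summable (Function.uncurry fun i k => r i * (u k / (s + q k)) / (p i - q k)) :=
    hsum₂
  rw [tsum_mul_tsum_of_summable_norm hrp huq, tsum_congr split, hsum₁.tsum_add hsum₂,
    hsum₁.tsum_prod, hsum₂.tsum_prod, ← hcomm.tsum_comm]
  congr 1
  · refine tsum_congr fun i => ?_
    rw [mul_div_right_comm, ← tsum_mul_left]
    exact tsum_congr fun k => by rw [neg_add_eq_sub, mul_div_assoc]
  · refine tsum_congr fun k => ?_
    rw [mul_div_right_comm, ← tsum_mul_left]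
    exact tsum_congr fun i => by rw [neg_add_eq_sub, mul_comm (r i), mul_div_assoc]

end PartialFractions

section Poles

lemma exists_pos_le_abs_sub_intCast {x : ℝ} (hx : ∀ n : ℤ, x ≠ n) :
    ∃ δ > 0, ∀ n : ℤ, δ ≤ |x - n| :=
  ⟨|x - round x|, abs_pos.2 (sub_ne_zero.2 (hx _)), round_le x⟩

lemma exists_pos_le_abs_add_natCast {x : ℝ} (hx : ∀ n : ℕ, x + n ≠ 0) :
    ∃ δ > 0, ∀ n : ℕ, δ ≤ |x + n| := by
  by_cases hint : ∃ m : ℤ, x = m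
  · obtain ⟨m, rfl⟩ := hint
    refine ⟨1, one_pos, fun n => ?_⟩
    have := hx n
    norm_cast at this ⊢
    exact Int.one_le_abs this
  · obtain ⟨δ, hδ, hle⟩ := exists_pos_le_abs_sub_intCast (not_exists.1 hint)
    exact ⟨δ, hδ, fun n => by simpa using hle (-n)⟩

lemma exists_pos_le_abs_progression_sub {x y : ℝ} (hxy : ∀ n : ℤ, y - x ≠ n) :
    ∃ η > 0, ∀ i k : ℕ, η ≤ |(y + k) - (x + i)| := by
  obtain ⟨η, hη, hle⟩ := exists_pos_le_abs_sub_intCast hxy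
  refine ⟨η, hη, fun i k => (hle (i - k)).trans_eq (congrArg abs ?_)⟩
  push_cast
  ring

end Poles

/-! ### Mellin transforms of power series on `(0, 1]` -/

section Mellin

open MeasureTheory Set

lemma integrableOn_rpow_sub_one {p : ℝ} (hp : 0 < p) :
    IntegrableOn (fun x : ℝ => x ^ (p - 1)) (Ioc 0 1) :=
  (intervalIntegrable_iff_integrableOn_Ioc_of_le zero_le_one).1
    (intervalIntegral.intervalIntegrable_rpow' (by linarith))

lemma setIntegral_rpow_sub_one {p : ℝ} (hp : 0 < p) :
    ∫ x in Ioc (0 : ℝ) 1, x ^ (p - 1) = 1 / p := by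
  rw [← intervalIntegral.integral_of_le zero_le_one, integral_rpow (Or.inl (by linarith))]
  simp [Real.zero_rpow hp.ne']

lemma integrableOn_rpow_mul_tsum {r : ℕ → ℝ} (hr : Summable r) {p : ℝ} (hp : 0 < p) :
    IntegrableOn (fun x : ℝ => x ^ (p - 1) * ∑' i, r i * x ^ i) (Ioc 0 1) :=
  Integrable.mul_bdd (integrableOn_rpow_sub_one hp)
    (((continuousOn_tsum_mul_pow hr).mono Ioc_subset_Icc_self).aestronglyMeasurable
      measurableSet_Ioc)
    (ae_restrict_of_forall_mem measurableSet_Ioc fun _ hx =>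
      tsum_of_norm_bounded hr.norm.hasSum fun i => norm_mul_pow_le (r i) (Ioc_subset_Icc_self hx) i)

lemma setIntegral_rpow_mul_tsum {r : ℕ → ℝ} (hr : Summable r) {p : ℝ} (hp : 0 < p) :
    ∫ x in Ioc (0 : ℝ) 1, x ^ (p - 1) * ∑' i, r i * x ^ i = ∑' i, r i / (p + i) := by
  have hpi (i : ℕ) : 0 < p + i := by positivity
  have hnorm (i : ℕ) :
      ∫ x in Ioc (0 : ℝ) 1, ‖r i * x ^ (p + i - 1)‖ = ‖r i / (p + i)‖ := by
    rw [norm_div, Real.norm_of_nonneg (hpi i).le, ← mul_one_div, ← setIntegral_rpow_sub_one (hpi i),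
      ← integral_const_mul]
    refine setIntegral_congr_fun measurableSet_Ioc fun x hx => ?_
    rw [norm_mul, Real.norm_of_nonneg (Real.rpow_nonneg hx.1.le _)]
  have hsum : Summable fun i => ‖r i / (p + i)‖ :=
    summable_norm_div_of_le hr.norm hp fun i => by
      rw [Real.norm_of_nonneg (hpi i).le]
      exact le_add_of_nonneg_right i.cast_nonneg
  have h := hasSum_integral_of_summable_integral_norm
    (fun i => (integrableOn_rpow_sub_one (hpi i)).const_mul (r i))
    (hsum.congr fun i => (hnorm i).symm)
  simp only [integral_const_mul, setIntegral_rpow_sub_one (hpi _), mul_one_div] at h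
  rw [h.tsum_eq]
  refine setIntegral_congr_fun measurableSet_Ioc fun x hx => ?_
  rw [← tsum_mul_left]
  refine tsum_congr fun i => ?_
  rw [add_sub_right_comm, Real.rpow_add_natCast hx.1.ne']
  ring

lemma ofReal_beta_integrand {x : ℝ} (hx : x ∈ Ioc 0 1) (t c : ℝ) :
    ((x ^ (t - 1) * (1 - x) ^ (c - 1) : ℝ) : ℂ) =
      (x : ℂ) ^ ((t : ℂ) - 1) * (1 - (x : ℂ)) ^ ((c : ℂ) - 1) := by
  rw [Complex.ofReal_mul, Complex.ofReal_cpow hx.1.le, Complex.ofReal_cpow (sub_nonneg.2 hx.2)]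
  push_cast
  rfl

lemma integrableOn_beta {t c : ℝ} (ht : 0 < t) (hc : 0 < c) :
    IntegrableOn (fun x : ℝ => x ^ (t - 1) * (1 - x) ^ (c - 1)) (Ioc 0 1) := by
  have h := Complex.betaIntegral_convergent (u := t) (v := c) (by simpa) (by simpa)
  rw [intervalIntegrable_iff_integrableOn_Ioc_of_le zero_le_one] at h
  refine h.re.congr (ae_restrict_of_forall_mem measurableSet_Ioc fun x hx => ?_)
  beta_reduce
  rw [← ofReal_beta_integrand hx]
  exact Complex.ofReal_re _

lemma setIntegral_beta {t c : ℝ} (ht : 0 < t) (hc : 0 < c) :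
    ∫ x in Ioc (0 : ℝ) 1, x ^ (t - 1) * (1 - x) ^ (c - 1) =
      Real.Gamma t * Real.Gamma c / Real.Gamma (t + c) := by
  rw [← ProbabilityTheory.beta, ProbabilityTheory.beta_eq_betaIntegralReal t c ht hc,
    Complex.betaIntegral, intervalIntegral.integral_of_le zero_le_one,
    ← setIntegral_congr_fun measurableSet_Ioc fun x hx => ofReal_beta_integrand hx t c,
    integral_complex_ofReal, Complex.ofReal_re]

lemma tsum_betaCoeff_div_of_pos {t c : ℝ} (ht : 0 < t) (hc : 1 < c) :
    ∑' k : ℕ, betaCoeff c k / (t + k) = Real.Gamma t / Real.Gamma (t + c) := by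
  have hc₀ : 0 < c := one_pos.trans hc
  have hΓ : Real.Gamma c ≠ 0 := (Real.Gamma_pos_of_pos hc₀).ne'
  calc ∑' k : ℕ, betaCoeff c k / (t + k)
      = ∫ x in Ioc (0 : ℝ) 1, x ^ (t - 1) * ∑' k : ℕ, betaCoeff c k * x ^ k :=
        (setIntegral_rpow_mul_tsum (summable_betaCoeff hc) ht).symm
    _ = ∫ x in Ioc (0 : ℝ) 1, x ^ (t - 1) * (1 - x) ^ (c - 1) / Real.Gamma c :=
        setIntegral_congr_fun measurableSet_Ioc fun x hx => by
          rw [tsum_betaCoeff_mul_pow hc (Ioc_subset_Icc_self hx), mul_div_assoc]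
    _ = Real.Gamma t / Real.Gamma (t + c) := by
        rw [integral_div, setIntegral_beta ht hc₀]
        field_simp

/-- The left side is `∑ k, (u k - u (k + 1))` for `u k = betaCoeff c k * k / (t + k)`. -/
lemma tsum_betaCoeff_div_succ {t c : ℝ} (hc : 1 < c) (ht : ∀ k : ℕ, t + k ≠ 0) :
    (t + c) * ∑' k : ℕ, betaCoeff c k / (t + 1 + k) - t * ∑' k : ℕ, betaCoeff c k / (t + k) =
      0 := by
  obtain ⟨δ, hδ, hle⟩ := exists_pos_le_abs_add_natCast ht
  have hb := summable_betaCoeff hc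
  have ht' (k : ℕ) : t + 1 + k = t + (k + 1 : ℕ) := by
    push_cast
    ring
  have hsum : Summable fun k : ℕ => betaCoeff c k / (t + k) := summable_div_of_le hb.norm hδ hle
  have hsum' : Summable fun k : ℕ => betaCoeff c k / (t + 1 + k) :=
    summable_div_of_le hb.norm hδ fun k => ht' k ▸ hle (k + 1)
  set u : ℕ → ℝ := fun k => betaCoeff c k - t * (betaCoeff c k / (t + k)) with hu
  have hsu : Summable u := hb.sub (hsum.mul_left t)
  have telescope (k : ℕ) :
      (t + c) * (betaCoeff c k / (t + 1 + k)) - t * (betaCoeff c k / (t + k)) =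
        u k - u (k + 1) := by
    have hk : t + k ≠ 0 := ht k
    have hk' : t + (k + 1) ≠ 0 := by exact_mod_cast ht (k + 1)
    have hsucc := betaCoeff_succ c k
    simp only [hu, ht', Nat.cast_add, Nat.cast_one]
    field_simp
    linear_combination (t + k) * hsucc
  have hu₀ : u 0 = 0 := by
    have : t ≠ 0 := by simpa using ht 0
    simp only [hu, Nat.cast_zero, add_zero, mul_div_cancel₀ _ this, sub_self]
  rw [← tsum_mul_left, ← tsum_mul_left, ← (hsum'.mul_left _).tsum_sub (hsum.mul_left _),
    tsum_congr telescope, hsu.tsum_sub ((summable_nat_add_iff 1).2 hsu), hsu.tsum_eq_zero_add, hu₀,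
    zero_add, sub_self]

lemma tsum_betaCoeff_div {t c : ℝ} (hc : 1 < c) (ht : ∀ k : ℕ, t + k ≠ 0) :
    ∑' k : ℕ, betaCoeff c k / (t + k) = Real.Gamma t / Real.Gamma (t + c) := by
  obtain ⟨N, hN⟩ := exists_nat_gt (-t)
  have hpos : 0 < t + N := by linarith
  clear hN
  induction N generalizing t with
  | zero => exact tsum_betaCoeff_div_of_pos (by simpa using hpos) hc
  | succ N ih =>
    have ht₀ : t ≠ 0 := by simpa using ht 0
    have ht' (k : ℕ) : t + 1 + k = t + (k + 1 : ℕ) := by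
      push_cast
      ring
    have h := sub_eq_zero.1 (tsum_betaCoeff_div_succ hc ht)
    rw [ih (fun k => ht' k ▸ ht (k + 1)) (ht' N ▸ hpos), Real.Gamma_add_one ht₀] at h
    refine mul_left_cancel₀ ht₀ (h.symm.trans ?_)
    by_cases htc : t + c = 0
    · rw [htc, Real.Gamma_zero]
      simp
    · rw [add_right_comm, Real.Gamma_add_one htc]
      field_simp

end Mellin

/-! ### Partial fractions of products of Gamma quotients -/

section GammaRatio

variable {ι : Type*} {a c : ι → ℝ} {S T : Finset ι} {r u : ι → ℕ → ℝ} {f g : ℝ → ℝ} {s : ℝ}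

/-- `f` is the sum of the simple fractions with residues `r l i` at the points `-(a l + i)`, where
`l ∈ S` and `i : ℕ`. The residues are required to be summable. -/
structure HasPartialFractions (a : ι → ℝ) (S : Finset ι) (r : ι → ℕ → ℝ) (f : ℝ → ℝ) : Prop where
  summable {l : ι} (hl : l ∈ S) : Summable (r l)
  eq_sum {s : ℝ} (hs : ∀ l ∈ S, ∀ i : ℕ, s + (a l + i) ≠ 0) :
    f s = ∑ l ∈ S, ∑' i : ℕ, r l i / (s + (a l + i))

namespace HasPartialFractions

lemma apply_neg (hg : HasPartialFractions a T u g) {x : ℝ} (hx : ∀ m ∈ T, ∀ n : ℤ, x - a m ≠ n)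
    (i : ℕ) : g (-(x + i)) = ∑ m ∈ T, ∑' k : ℕ, u m k / (-(x + i) + (a m + k)) :=
  hg.eq_sum fun m hm k h => hx m hm (k - i) <| by
    push_cast
    linarith

lemma summable_mul_apply_neg (hg : HasPartialFractions a T u g) {r : ℕ → ℝ} (hr : Summable r)
    {x : ℝ} (hx : ∀ m ∈ T, ∀ n : ℤ, x - a m ≠ n) :
    Summable fun i : ℕ => r i * g (-(x + i)) := by
  simp only [hg.apply_neg hx, Finset.mul_sum]
  refine summable_sum fun m hm => ?_
  obtain ⟨η, hη, hle⟩ := exists_pos_le_abs_progression_sub (hx m hm)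
  exact summable_mul_tsum_div_of_le hr.norm (hg.summable hm).norm hη fun i k =>
    (hle k i).trans_eq (abs_sub_comm _ _)

lemma sum_tsum_mul_tsum_div (hg : HasPartialFractions a T u g) {r : ℕ → ℝ} (hr : Summable r)
    {x : ℝ} (hx : ∀ m ∈ T, ∀ n : ℤ, x - a m ≠ n) (hs : ∀ i : ℕ, s + (x + i) ≠ 0) :
    ∑ m ∈ T, ∑' i : ℕ, r i * (∑' k : ℕ, u m k / (-(x + i) + (a m + k))) / (s + (x + i)) =
      ∑' i : ℕ, r i * g (-(x + i)) / (s + (x + i)) := by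
  simp only [hg.apply_neg hx, Finset.mul_sum, Finset.sum_div]
  refine (Summable.tsum_finsetSum fun m hm => ?_).symm
  obtain ⟨δ, hδ, hle⟩ := exists_pos_le_abs_add_natCast (x := s + x) (by simpa only [add_assoc])
  obtain ⟨η, hη, hle'⟩ := exists_pos_le_abs_progression_sub (hx m hm)
  refine summable_div_of_le (Summable.norm ?_) hδ
    (by simpa only [add_assoc, Real.norm_eq_abs] using hle)
  exact summable_mul_tsum_div_of_le hr.norm (hg.summable hm).norm hη fun i k =>
    (hle' k i).trans_eq (abs_sub_comm _ _)

lemma tsum_mul_tsum (hf : HasPartialFractions a S r f) (hg : HasPartialFractions a T u g)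
    {l m : ι} (hl : l ∈ S) (hm : m ∈ T) (hlm : ∀ n : ℤ, a l - a m ≠ n)
    (hsl : ∀ i : ℕ, s + (a l + i) ≠ 0) (hsm : ∀ k : ℕ, s + (a m + k) ≠ 0) :
    (∑' i : ℕ, r l i / (s + (a l + i))) * (∑' k : ℕ, u m k / (s + (a m + k))) =
      ∑' i : ℕ, r l i * (∑' k : ℕ, u m k / (-(a l + i) + (a m + k))) / (s + (a l + i)) +
        ∑' k : ℕ, u m k * (∑' i : ℕ, r l i / (-(a m + k) + (a l + i))) / (s + (a m + k)) := by
  obtain ⟨δ, hδ, hle⟩ := exists_pos_le_abs_add_natCast (x := s + a l) (by simpa only [add_assoc])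
  obtain ⟨ε, hε, hle'⟩ := exists_pos_le_abs_add_natCast (x := s + a m) (by simpa only [add_assoc])
  obtain ⟨η, hη, hsep⟩ := exists_pos_le_abs_progression_sub hlm
  exact tsum_div_mul_tsum_div (hf.summable hl).norm (hg.summable hm).norm hδ hε hη
    (by simpa only [add_assoc, Real.norm_eq_abs] using hle)
    (by simpa only [add_assoc, Real.norm_eq_abs] using hle')
    fun i k => (hsep k i).trans_eq (abs_sub_comm _ _)

theorem mul [DecidableEq ι] {v : ι → ℕ → ℝ} (hf : HasPartialFractions a S r f)
    (hg : HasPartialFractions a T u g) (hST : ∀ l ∈ S, ∀ m ∈ T, ∀ n : ℤ, a l - a m ≠ n)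
    (hvS : ∀ l ∈ S, ∀ i : ℕ, v l i = r l i * g (-(a l + i)))
    (hvT : ∀ m ∈ T, ∀ k : ℕ, v m k = u m k * f (-(a m + k))) :
    HasPartialFractions a (S ∪ T) v fun s => f s * g s := by
  have hTS (m : ι) (hm : m ∈ T) (l : ι) (hl : l ∈ S) (n : ℤ) : a m - a l ≠ n := fun h =>
    hST l hl m hm (-n) (by push_cast; linarith)
  have hdisj : Disjoint S T := Finset.disjoint_left.2 fun l hS hT => hST l hS l hT 0 (by simp)
  refine ⟨fun {l} hl => ?_, fun {s} hs => ?_⟩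
  · rcases Finset.mem_union.1 hl with hl | hl
    · exact (hg.summable_mul_apply_neg (hf.summable hl) (hST l hl)).congr fun i => (hvS l hl i).symm
    · exact (hf.summable_mul_apply_neg (hg.summable hl) (hTS l hl)).congr fun i => (hvT l hl i).symm
  · have hsS (l : ι) (hl : l ∈ S) := hs l (Finset.mem_union_left T hl)
    have hsT (m : ι) (hm : m ∈ T) := hs m (Finset.mem_union_right S hm)
    rw [hf.eq_sum hsS, hg.eq_sum hsT, Finset.sum_mul_sum, Finset.sum_union hdisj,
      Finset.sum_congr rfl fun l hl => Finset.sum_congr rfl fun m hm =>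
        hf.tsum_mul_tsum hg hl hm (hST l hl m hm) (hsS l hl) (hsT m hm)]
    simp only [Finset.sum_add_distrib]
    congr 1
    · refine Finset.sum_congr rfl fun l hl => ?_
      rw [hg.sum_tsum_mul_tsum_div (hf.summable hl) (hST l hl) (hsS l hl)]
      simp only [hvS l hl]
    · rw [Finset.sum_comm]
      refine Finset.sum_congr rfl fun m hm => ?_
      rw [hf.sum_tsum_mul_tsum_div (hg.summable hm) (hTS m hm) (hsT m hm)]
      simp only [hvT m hm]

end HasPartialFractions

/-- The product `∏_{l ∈ S} Γ(s + a_l) / Γ(s + a_l + c_l)`. -/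
noncomputable def gammaRatio (a c : ι → ℝ) (S : Finset ι) (s : ℝ) : ℝ :=
  ∏ l ∈ S, Real.Gamma (s + a l) / Real.Gamma (s + a l + c l)

variable [DecidableEq ι]

/-- The residue of `gammaRatio a c S` at the pole `-(a l + i)`. -/
noncomputable def gammaRes (a c : ι → ℝ) (S : Finset ι) (l : ι) (i : ℕ) : ℝ :=
  betaCoeff (c l) i * gammaRatio a c (S.erase l) (-(a l + i))

lemma gammaRatio_union (h : Disjoint S T) (s : ℝ) :
    gammaRatio a c (S ∪ T) s = gammaRatio a c S s * gammaRatio a c T s :=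
  Finset.prod_union h

lemma gammaRes_union_of_mem_left (h : Disjoint S T) {l : ι} (hl : l ∈ S) (i : ℕ) :
    gammaRes a c (S ∪ T) l i = gammaRes a c S l i * gammaRatio a c T (-(a l + i)) := by
  have hlT : l ∉ T := Finset.disjoint_left.1 h hl
  rw [gammaRes, gammaRes, Finset.erase_union_distrib, Finset.erase_eq_of_notMem hlT,
    gammaRatio_union (h.mono_left (Finset.erase_subset l S)), mul_assoc]

lemma gammaRes_union_of_mem_right (h : Disjoint S T) {l : ι} (hl : l ∈ T) (i : ℕ) :
    gammaRes a c (S ∪ T) l i = gammaRes a c T l i * gammaRatio a c S (-(a l + i)) := by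
  rw [Finset.union_comm, gammaRes_union_of_mem_left h.symm hl]

lemma hasPartialFractions_gammaRatio_singleton {m : ι} (hc : 1 < c m) :
    HasPartialFractions a {m} (gammaRes a c {m}) (gammaRatio a c {m}) := by
  have hres : gammaRes a c {m} m = betaCoeff (c m) := funext fun i => by
    simp [gammaRes, gammaRatio]
  refine ⟨fun {l} hl => ?_, fun {s} hs => ?_⟩
  · rw [Finset.mem_singleton.1 hl, hres]
    exact summable_betaCoeff hc
  · have hs' (i : ℕ) : s + a m + i ≠ 0 := by
      simpa only [add_assoc] using hs m (Finset.mem_singleton_self m) i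
    rw [Finset.sum_singleton, hres, gammaRatio, Finset.prod_singleton, ← tsum_betaCoeff_div hc hs']
    simp only [add_assoc]

theorem hasPartialFractions_gammaRatio (hS : S.Nonempty) (hc : ∀ l ∈ S, 1 < c l)
    (ha : (S : Set ι).Pairwise fun l m => ∀ n : ℤ, a l - a m ≠ n) :
    HasPartialFractions a S (gammaRes a c S) (gammaRatio a c S) := by
  induction hS using Finset.Nonempty.cons_induction with
  | singleton m =>
    exact hasPartialFractions_gammaRatio_singleton (hc m (Finset.mem_singleton_self m))
  | cons m S hm _ ih =>
    rw [Finset.cons_eq_insert] at *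
    have hdisj : Disjoint {m} S := Finset.disjoint_singleton_left.2 hm
    have hsep (l : ι) (hl : l ∈ S) : ∀ n : ℤ, a m - a l ≠ n :=
      ha (Finset.mem_insert_self m S) (Finset.mem_insert_of_mem hl)
        (ne_of_mem_of_not_mem hl hm).symm
    have hfS := ih (fun l hl => hc l (Finset.mem_insert_of_mem hl))
      (ha.mono (Finset.coe_subset.2 (Finset.subset_insert m S)))
    have hfm := hasPartialFractions_gammaRatio_singleton (a := a)
      (hc m (Finset.mem_insert_self m S))
    rw [Finset.insert_eq, funext (gammaRatio_union hdisj)]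
    exact hfm.mul hfS (by simpa using hsep) (fun _ hl => gammaRes_union_of_mem_left hdisj hl)
      fun _ hl => gammaRes_union_of_mem_right hdisj hl

end GammaRatio

/-! ### Determinacy of the moment problem on a bounded interval -/

section Moments

open MeasureTheory Set

variable {f g : ℝ → ℝ} {a b R : ℝ}

lemma integrableOn_Ioc_continuous_mul (hf : IntegrableOn f (Ioc a b)) (hg : Continuous g) :
    IntegrableOn (fun x => g x * f x) (Ioc a b) :=
  hf.continuousOn_mul_of_subset hg.continuousOn isCompact_Icc measurableSet_Ioc Ioc_subset_Icc_self

lemma setIntegral_eval_mul_eq_zero (hf : IntegrableOn f (Ioc a b))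
    (hm : ∀ n : ℕ, ∫ x in Ioc a b, x ^ n * f x = 0) (p : Polynomial ℝ) :
    ∫ x in Ioc a b, p.eval x * f x = 0 := by
  simp only [Polynomial.eval_eq_sum_range, Finset.sum_mul, mul_assoc]
  rw [integral_finsetSum _ fun i _ =>
    (integrableOn_Ioc_continuous_mul hf (continuous_pow i)).const_mul (p.coeff i)]
  simp only [integral_const_mul, hm, mul_zero, Finset.sum_const_zero]

lemma setIntegral_continuous_mul_eq_zero (hf : IntegrableOn f (Ioc a b))
    (hm : ∀ n : ℕ, ∫ x in Ioc a b, x ^ n * f x = 0) (hg : Continuous g) :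
    ∫ x in Ioc a b, g x * f x = 0 := by
  set I := ∫ x in Ioc a b, |f x|
  have : 0 ≤ I := integral_nonneg fun _ => abs_nonneg _
  have hbound (ε : ℝ) (hε : 0 < ε) : |∫ x in Ioc a b, g x * f x| ≤ ε * I := by
    obtain ⟨p, hp⟩ := exists_polynomial_near_of_continuousOn a b g hg.continuousOn ε hε
    rw [← sub_zero (∫ x in Ioc a b, g x * f x), ← setIntegral_eval_mul_eq_zero hf hm p,
      ← integral_sub (integrableOn_Ioc_continuous_mul hf hg)
        (integrableOn_Ioc_continuous_mul hf p.continuous), ← integral_const_mul,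
      ← Real.norm_eq_abs]
    refine norm_integral_le_of_norm_le (hf.abs.const_mul ε)
      (ae_restrict_of_forall_mem measurableSet_Ioc fun x hx => ?_)
    rw [← sub_mul, norm_mul, Real.norm_eq_abs, Real.norm_eq_abs, abs_sub_comm]
    gcongr
    exact (hp x (Ioc_subset_Icc_self hx)).le
  refine abs_nonpos_iff.1 (le_of_forall_pos_le_add fun δ hδ => ?_)
  refine (hbound (δ / (I + 1)) (by positivity)).trans ?_
  rw [zero_add, div_mul_eq_mul_div, div_le_iff₀ (by positivity)]
  gcongr
  exact le_add_of_nonneg_right zero_le_one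

lemma ae_eq_zero_of_moments_eq_zero (hf : IntegrableOn f (Ioc a b))
    (hm : ∀ n : ℕ, ∫ x in Ioc a b, x ^ n * f x = 0) : f =ᵐ[volume.restrict (Ioc a b)] 0 :=
  ae_eq_zero_of_integral_contDiff_smul_eq_zero hf.locallyIntegrable fun _ hg _ =>
    setIntegral_continuous_mul_eq_zero hf hm hg.continuous

lemma ae_eq_of_moments_eq (hf : IntegrableOn f (Ioc a b)) (hg : IntegrableOn g (Ioc a b))
    (h : ∀ n : ℕ, ∫ x in Ioc a b, x ^ n * f x = ∫ x in Ioc a b, x ^ n * g x) :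
    f =ᵐ[volume.restrict (Ioc a b)] g := by
  rw [Filter.eventuallyEq_iff_sub]
  refine ae_eq_zero_of_moments_eq_zero (hf.sub hg) fun n => ?_
  have hpow := continuous_pow (M := ℝ) n
  simp only [Pi.sub_apply, mul_sub]
  rw [integral_sub (integrableOn_Ioc_continuous_mul hf hpow)
    (integrableOn_Ioc_continuous_mul hg hpow), h, sub_self]

lemma eqOn_Ioc_of_moments_eq (hf : ContinuousOn f (Ioc a b)) (hg : ContinuousOn g (Ioc a b))
    (hfi : IntegrableOn f (Ioc a b)) (hgi : IntegrableOn g (Ioc a b))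
    (h : ∀ n : ℕ, ∫ x in Ioc a b, x ^ n * f x = ∫ x in Ioc a b, x ^ n * g x) :
    EqOn f g (Ioc a b) :=
  Measure.eqOn_Ioc_of_ae_eq volume (ae_eq_of_moments_eq hfi hgi h) hf hg

lemma eqOn_zero_of_moments_eq (haR : a ≤ R) (hRb : R ≤ b) (hf : IntegrableOn f (Ioc a R))
    (hg : IntegrableOn g (Ioc a b)) (hgc : ContinuousOn g (Ioc R b))
    (h : ∀ n : ℕ, ∫ x in Ioc a R, x ^ n * f x = ∫ x in Ioc a b, x ^ n * g x) :
    EqOn g 0 (Ioc R b) := by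
  have hind : IntegrableOn ((Ioc a R).indicator f) (Ioc a b) :=
    ((integrable_indicator_iff measurableSet_Ioc).2 hf).integrableOn
  have hae := ae_eq_of_moments_eq hg hind fun n => by
    have hmul : (fun x => x ^ n * (Ioc a R).indicator f x) =
        (Ioc a R).indicator fun x => x ^ n * f x :=
      funext fun x => (indicator_mul_right (Ioc a R) (fun x => x ^ n) f).symm
    rw [hmul, setIntegral_indicator measurableSet_Ioc,
      inter_eq_self_of_subset_right (Ioc_subset_Ioc_right hRb), h]
  refine Measure.eqOn_Ioc_of_ae_eq volume ?_ hgc continuousOn_const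
  filter_upwards [ae_restrict_of_ae_restrict_of_subset (Ioc_subset_Ioc_left haR) hae,
    ae_restrict_mem measurableSet_Ioc] with x hx hxR
  rw [hx, indicator_of_notMem fun hmem => hxR.1.not_ge hmem.2, Pi.zero_apply]

end Moments

namespace IsCatalanWeight

open Set

variable {d : ℕ} {R R' : ℝ} {W W' : ℝ → ℝ}

lemma pos (h : IsCatalanWeight d R W) : 0 < R := by
  obtain ⟨x, hx, -⟩ := h.isLUB_support.nonempty
  exact hx.1.trans_le hx.2

lemma integrableOn_self (h : IsCatalanWeight d R W) : MeasureTheory.IntegrableOn W (Ioc 0 R) := by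
  simpa using h.integrableOn 0

lemma le (h : IsCatalanWeight d R W) (h' : IsCatalanWeight d R' W') : R' ≤ R := by
  by_contra! hlt
  have hzero : EqOn W' 0 (Ioc R R') :=
    eqOn_zero_of_moments_eq h.pos.le hlt.le h.integrableOn_self h'.integrableOn_self
      (h'.continuousOn.mono (Ioc_subset_Ioc_left h.pos.le)) fun n => by rw [h.moment, h'.moment]
  refine hlt.not_ge (h'.isLUB_support.2 ?_)
  rintro x ⟨hx, hWx⟩
  by_contra! hRx
  exact hWx (hzero ⟨hRx, hx.2⟩)

lemma unique (h : IsCatalanWeight d R W) (h' : IsCatalanWeight d R' W') :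
    R = R' ∧ EqOn W W' (Ioc 0 R) := by
  obtain rfl := le_antisymm (h'.le h) (h.le h')
  exact ⟨rfl, eqOn_Ioc_of_moments_eq h.continuousOn h'.continuousOn h.integrableOn_self
    h'.integrableOn_self fun n => by rw [h.moment, h'.moment]⟩

end IsCatalanWeight

/-! ### Multiplicative convolution of weights on (0, 1) -/

/-- `w` is a positive weight on `(0, 1)` with power moments `m`. It is extended by zero to
`[1, ∞)`, so that moments and multiplicative convolutions are integrals over `(0, ∞)`. -/
structure IsUnitWeight (w : ℝ → ℝ) (m : ℕ → ℝ) : Prop where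
  continuousOn : ContinuousOn w (Set.Ioi 0)
  eq_zero {x : ℝ} (hx : 1 ≤ x) : w x = 0
  pos {x : ℝ} (h0 : 0 < x) (h1 : x < 1) : 0 < w x
  integrableOn (n : ℕ) : MeasureTheory.IntegrableOn (fun x : ℝ => x ^ n * w x) (Set.Ioi 0)
  moment (n : ℕ) : ∫ x in Set.Ioi (0 : ℝ), x ^ n * w x = m n

/-- The multiplicative convolution of `w` and `b`: the density of a product of independent random
variables on `(0, ∞)` with densities `w` and `b`. -/
noncomputable def mulConv (w b : ℝ → ℝ) (x : ℝ) : ℝ :=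
  ∫ y in Set.Ioi (0 : ℝ), w y * (b (x / y) / y)

section MulConv

open MeasureTheory Set

variable {w b f : ℝ → ℝ} {m m' : ℕ → ℝ} {D : ℝ}

lemma pow_mul_comp_div (hD : D ≠ 0) (f : ℝ → ℝ) (n : ℕ) (x : ℝ) :
    x ^ n * f (x / D) = D ^ n * (fun u => u ^ n * f u) (D⁻¹ * x) := by
  rw [div_eq_inv_mul]
  beta_reduce
  rw [← mul_assoc, ← mul_pow, mul_inv_cancel_left₀ hD]

lemma integrableOn_pow_mul_comp_div (hD : 0 < D) {n : ℕ}
    (hf : IntegrableOn (fun u => u ^ n * f u) (Ioi 0)) :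
    IntegrableOn (fun x => x ^ n * f (x / D)) (Ioi 0) := by
  simp only [pow_mul_comp_div hD.ne']
  refine Integrable.const_mul ?_ _
  rw [← IntegrableOn, integrableOn_Ioi_comp_mul_left_iff (fun u => u ^ n * f u) 0 (inv_pos.2 hD),
    mul_zero]
  exact hf

lemma setIntegral_pow_mul_comp_div (hD : 0 < D) (f : ℝ → ℝ) (n : ℕ) :
    ∫ x in Ioi 0, x ^ n * f (x / D) = D ^ (n + 1) * ∫ u in Ioi 0, u ^ n * f u := by
  simp only [pow_mul_comp_div hD.ne']
  rw [integral_const_mul, integral_comp_mul_left_Ioi (fun u => u ^ n * f u) 0 (inv_pos.2 hD),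
    mul_zero, smul_eq_mul, inv_inv, pow_succ, mul_assoc]

namespace IsUnitWeight

lemma nonneg (hw : IsUnitWeight w m) {x : ℝ} (hx : 0 < x) : 0 ≤ w x :=
  (lt_or_ge x 1).elim (fun h1 => (hw.pos hx h1).le) fun h1 => (hw.eq_zero h1).ge

lemma integrableOn_self (hw : IsUnitWeight w m) : IntegrableOn w (Ioi 0) := by
  simpa using hw.integrableOn 0

lemma setIntegral_Ioc (hw : IsUnitWeight w m) (n : ℕ) :
    ∫ x in Ioc 0 1, x ^ n * w x = m n := by
  rw [← hw.moment n]
  refine (setIntegral_eq_of_subset_of_forall_sdiff_eq_zero measurableSet_Ioi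
    Ioc_subset_Ioi_self fun x hx => ?_).symm
  rw [hw.eq_zero (not_le.1 fun h1 => hx.2 ⟨hx.1, h1⟩).le, mul_zero]

lemma exists_forall_abs_le (hw : IsUnitWeight w m) {ε : ℝ} (hε : 0 < ε) :
    ∃ C, 0 ≤ C ∧ ∀ x, ε ≤ x → |w x| ≤ C := by
  obtain ⟨C, hC⟩ := (isCompact_Icc (a := ε) (b := 1)).exists_bound_of_continuousOn
    (hw.continuousOn.mono fun x hx => hε.trans_le hx.1)
  refine ⟨max C 0, le_max_right _ _, fun x hx => ?_⟩
  rcases le_or_gt x 1 with h1 | h1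
  · exact (hC x ⟨hx, h1⟩).trans (le_max_left _ _)
  · rw [hw.eq_zero h1.le, abs_zero]
    exact le_max_right _ _

lemma mulConv_integrand_nonneg (hw : IsUnitWeight w m) (hb : IsUnitWeight b m') {x y : ℝ}
    (hx : 0 < x) (hy : 0 < y) : 0 ≤ w y * (b (x / y) / y) :=
  mul_nonneg (hw.nonneg hy) (div_nonneg (hb.nonneg (div_pos hx hy)) hy.le)

lemma norm_mulConv_integrand_le (hw : IsUnitWeight w m) (hb : IsUnitWeight b m')
    {ε C x y : ℝ} (hε : 0 < ε) (hC₀ : 0 ≤ C) (hC : ∀ x, ε ≤ x → |b x| ≤ C) (hx : ε ≤ x)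
    (hy : 0 < y) : ‖w y * (b (x / y) / y)‖ ≤ |w y| * (C / ε) := by
  rw [norm_mul, Real.norm_eq_abs, Real.norm_eq_abs]
  rcases le_or_gt 1 y with h1y | hy1
  · simp [hw.eq_zero h1y]
  refine mul_le_mul_of_nonneg_left ?_ (abs_nonneg _)
  rcases le_or_gt y x with hyx | hxy
  · rw [hb.eq_zero ((one_le_div hy).2 hyx), zero_div, abs_zero]
    positivity
  · have hεxy : ε ≤ x / y := hx.trans ((le_div_iff₀ hy).2
      (mul_le_of_le_one_right (hε.le.trans hx) hy1.le))
    rw [abs_div, abs_of_pos hy]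
    exact div_le_div₀ hC₀ (hC _ hεxy) hε (hx.trans hxy.le)

lemma continuousOn_comp_div (hb : IsUnitWeight b m') :
    ContinuousOn (fun z : ℝ × ℝ => b (z.1 / z.2) / z.2) (Ioi 0 ×ˢ Ioi 0) := by
  have hne : ∀ z ∈ (Ioi (0 : ℝ) ×ˢ Ioi (0 : ℝ)), z.2 ≠ 0 := fun z hz => ne_of_gt hz.2
  exact (hb.continuousOn.comp (continuousOn_fst.div continuousOn_snd hne)
    fun z hz => mem_Ioi.2 (div_pos hz.1 hz.2)).div continuousOn_snd hne

lemma aestronglyMeasurable_mulConv_integrand (hw : IsUnitWeight w m) (hb : IsUnitWeight b m')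
    {x : ℝ} (hx : 0 < x) :
    AEStronglyMeasurable (fun y => w y * (b (x / y) / y)) (volume.restrict (Ioi 0)) :=
  (hw.continuousOn.mul (hb.continuousOn_comp_div.comp
    (f := fun y : ℝ => (x, y)) (by fun_prop) fun _ hy => ⟨hx, hy⟩)).aestronglyMeasurable
      measurableSet_Ioi

lemma integrableOn_mulConv_integrand (hw : IsUnitWeight w m) (hb : IsUnitWeight b m')
    {x : ℝ} (hx : 0 < x) : IntegrableOn (fun y => w y * (b (x / y) / y)) (Ioi 0) := by
  obtain ⟨C, hC₀, hC⟩ := hb.exists_forall_abs_le hx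
  exact (hw.integrableOn_self.abs.mul_const (C / x)).mono'
    (hw.aestronglyMeasurable_mulConv_integrand hb hx)
    (ae_restrict_of_forall_mem measurableSet_Ioi fun y hy =>
      hw.norm_mulConv_integrand_le hb hx hC₀ hC le_rfl hy)

lemma continuousOn_mulConv (hw : IsUnitWeight w m) (hb : IsUnitWeight b m') :
    ContinuousOn (mulConv w b) (Ioi 0) := by
  intro x₀ (hx₀ : 0 < x₀)
  obtain ⟨C, hC₀, hC⟩ := hb.exists_forall_abs_le (half_pos hx₀)
  have hnear : ∀ᶠ x in nhds x₀, x₀ / 2 ≤ x := Ici_mem_nhds (half_lt_self hx₀)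
  refine (continuousAt_of_dominated (bound := fun y => |w y| * (C / (x₀ / 2)))
    (hnear.mono fun x hx =>
      hw.aestronglyMeasurable_mulConv_integrand hb ((half_pos hx₀).trans_le hx))
    (hnear.mono fun x hx => ae_restrict_of_forall_mem measurableSet_Ioi fun y hy =>
      hw.norm_mulConv_integrand_le hb (half_pos hx₀) hC₀ hC hx hy)
    (hw.integrableOn_self.abs.mul_const _)
    (ae_restrict_of_forall_mem measurableSet_Ioi fun y hy => ?_)).continuousWithinAt
  have hb₀ : ContinuousAt b (x₀ / y) :=
    hb.continuousOn.continuousAt (Ioi_mem_nhds (div_pos hx₀ hy))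
  exact continuousAt_const.mul
    ((hb₀.comp (f := fun x : ℝ => x / y) (continuousAt_id.div_const y)).div_const y)

lemma mulConv_eq_zero (hw : IsUnitWeight w m) (hb : IsUnitWeight b m') {x : ℝ} (hx : 1 ≤ x) :
    mulConv w b x = 0 := by
  refine setIntegral_eq_zero_of_forall_eq_zero fun y (hy : 0 < y) => ?_
  rcases le_or_gt 1 y with h1y | hy1
  · rw [hw.eq_zero h1y, zero_mul]
  · rw [hb.eq_zero ((one_le_div hy).2 (hy1.le.trans hx)), zero_div, mul_zero]

lemma mulConv_pos (hw : IsUnitWeight w m) (hb : IsUnitWeight b m') {x : ℝ} (h0 : 0 < x)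
    (h1 : x < 1) : 0 < mulConv w b x := by
  rw [mulConv, setIntegral_pos_iff_support_of_nonneg_ae
    (ae_restrict_of_forall_mem measurableSet_Ioi fun _ => hw.mulConv_integrand_nonneg hb h0)
    (hw.integrableOn_mulConv_integrand hb h0)]
  refine ((Measure.measure_Ioo_pos volume).2 h1).trans_le (measure_mono fun y hy => ?_)
  have hy₀ : 0 < y := h0.trans hy.1
  have hbxy : 0 < b (x / y) := hb.pos (div_pos h0 hy₀) ((div_lt_one hy₀).2 hy.1)
  exact ⟨(mul_pos (hw.pos hy₀ hy.2) (div_pos hbxy hy₀)).ne', hy₀⟩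

lemma integrableOn_pow_mul_mulConv_integrand (hb : IsUnitWeight b m') (n : ℕ) {y : ℝ}
    (hy : 0 < y) (w : ℝ → ℝ) : IntegrableOn (fun x => x ^ n * (w y * (b (x / y) / y))) (Ioi 0) := by
  refine IntegrableOn.congr_fun ((integrableOn_pow_mul_comp_div hy (hb.integrableOn n)).const_mul
    (w y / y)) (fun x _ => ?_) measurableSet_Ioi
  ring

lemma setIntegral_pow_mul_mulConv_integrand (hb : IsUnitWeight b m') (n : ℕ) {y : ℝ}
    (hy : 0 < y) (w : ℝ → ℝ) :
    ∫ x in Ioi 0, x ^ n * (w y * (b (x / y) / y)) = y ^ n * w y * m' n := by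
  have hcomm (x : ℝ) : x ^ n * (w y * (b (x / y) / y)) = w y / y * (x ^ n * b (x / y)) := by ring
  simp only [hcomm]
  rw [integral_const_mul, setIntegral_pow_mul_comp_div hy, hb.moment]
  field_simp
  ring

lemma integrable_prod_pow_mul_mulConv_integrand (hw : IsUnitWeight w m) (hb : IsUnitWeight b m')
    (n : ℕ) : Integrable (Function.uncurry fun x y : ℝ => x ^ n * (w y * (b (x / y) / y)))
      ((volume.restrict (Ioi 0)).prod (volume.restrict (Ioi 0))) := by
  refine (integrable_prod_iff' ?_).2 ⟨?_, ?_⟩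
  · rw [Measure.prod_restrict]
    refine ContinuousOn.aestronglyMeasurable ?_ (measurableSet_Ioi.prod measurableSet_Ioi)
    exact (continuousOn_fst.pow n).mul
      ((hw.continuousOn.comp continuousOn_snd fun z hz => hz.2).mul hb.continuousOn_comp_div)
  · exact ae_restrict_of_forall_mem measurableSet_Ioi fun y hy =>
      hb.integrableOn_pow_mul_mulConv_integrand n hy w
  · refine IntegrableOn.congr_fun ((hw.integrableOn n).mul_const (m' n)) (fun y (hy : 0 < y) => ?_)
      measurableSet_Ioi
    rw [← hb.setIntegral_pow_mul_mulConv_integrand n hy w]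
    exact setIntegral_congr_fun measurableSet_Ioi fun x (hx : 0 < x) =>
      (Real.norm_of_nonneg
        (mul_nonneg (pow_nonneg hx.le n) (hw.mulConv_integrand_nonneg hb hx hy))).symm

protected theorem mulConv (hw : IsUnitWeight w m) (hb : IsUnitWeight b m') :
    IsUnitWeight (mulConv w b) fun n => m n * m' n where
  continuousOn := hw.continuousOn_mulConv hb
  eq_zero := hw.mulConv_eq_zero hb
  pos := hw.mulConv_pos hb
  integrableOn n := by
    simpa only [IntegrableOn, _root_.mulConv, Function.uncurry_apply_pair, integral_const_mul] using
      (hw.integrable_prod_pow_mul_mulConv_integrand hb n).integral_prod_left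
  moment n := by
    simp only [_root_.mulConv, ← integral_const_mul]
    rw [integral_integral_swap (hw.integrable_prod_pow_mul_mulConv_integrand hb n),
      setIntegral_congr_fun measurableSet_Ioi fun y hy =>
        hb.setIntegral_pow_mul_mulConv_integrand n hy w, integral_mul_const, hw.moment]

end IsUnitWeight

end MulConv

/-! ### Beta densities and their convolutions -/

/-- The density on `(0, 1)` with moments `Γ(n + a) / Γ(n + a + c)`, extended by zero. -/
noncomputable def betaDensity (a c x : ℝ) : ℝ :=
  x ^ (a - 1) * max (1 - x) 0 ^ (c - 1) / Real.Gamma c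

section BetaDensity

open MeasureTheory Set

variable {a c x : ℝ}

lemma betaDensity_eq_zero (hc : 1 < c) (hx : 1 ≤ x) : betaDensity a c x = 0 := by
  rw [betaDensity, max_eq_right (by linarith), Real.zero_rpow (by linarith), mul_zero, zero_div]

lemma betaDensity_pos (hc : 0 < c) (h0 : 0 < x) (h1 : x < 1) : 0 < betaDensity a c x := by
  have hx : 0 < 1 - x := sub_pos.2 h1
  have := Real.Gamma_pos_of_pos hc
  rw [betaDensity, max_eq_left hx.le]
  positivity

lemma continuousOn_betaDensity (hc : 1 < c) : ContinuousOn (betaDensity a c) (Ioi 0) := by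
  intro x (hx : 0 < x)
  refine ContinuousAt.continuousWithinAt (ContinuousAt.div_const (ContinuousAt.mul ?_ ?_) _)
  · exact Real.continuousAt_rpow_const _ _ (Or.inl hx.ne')
  · exact ContinuousAt.rpow_const (by fun_prop) (Or.inr (by linarith))

lemma pow_mul_betaDensity (n : ℕ) (hx : x ∈ Ioc 0 1) :
    x ^ n * betaDensity a c x = x ^ (n + a - 1) * (1 - x) ^ (c - 1) / Real.Gamma c := by
  rw [betaDensity, max_eq_left (by linarith [hx.2]), add_sub_assoc, Real.rpow_add hx.1,
    Real.rpow_natCast]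
  ring

lemma isUnitWeight_betaDensity (ha : 0 < a) (hc : 1 < c) :
    IsUnitWeight (betaDensity a c) fun n => Real.Gamma (n + a) / Real.Gamma (n + a + c) := by
  have hc₀ : 0 < c := one_pos.trans hc
  have hna (n : ℕ) : 0 < n + a := by positivity
  have hzero (n : ℕ) : ∀ x ∈ Ioi (0 : ℝ) \ Ioc 0 1, x ^ n * betaDensity a c x = 0 := fun x hx => by
    rw [betaDensity_eq_zero hc (not_le.1 fun h1 => hx.2 ⟨hx.1, h1⟩).le, mul_zero]
  refine ⟨continuousOn_betaDensity hc, betaDensity_eq_zero hc, betaDensity_pos hc₀,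
    fun n => ?_, fun n => ?_⟩
  · refine IntegrableOn.of_forall_sdiff_eq_zero (s := Ioc 0 1) ?_ measurableSet_Ioi (hzero n)
    exact IntegrableOn.congr_fun (Integrable.div_const (integrableOn_beta (hna n) hc₀) _)
      (fun x hx => (pow_mul_betaDensity n hx).symm) measurableSet_Ioc
  · have hΓ := (Real.Gamma_pos_of_pos hc₀).ne'
    rw [setIntegral_eq_of_subset_of_forall_sdiff_eq_zero measurableSet_Ioi Ioc_subset_Ioi_self
        (hzero n), setIntegral_congr_fun measurableSet_Ioc fun x hx => pow_mul_betaDensity n hx,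
      integral_div, setIntegral_beta (hna n) hc₀]
    field_simp

end BetaDensity

theorem exists_isUnitWeight_gammaRatio {ι : Type*} {a c : ι → ℝ} {S : Finset ι}
    (hS : S.Nonempty) (ha : ∀ l ∈ S, 0 < a l) (hc : ∀ l ∈ S, 1 < c l) :
    ∃ w, IsUnitWeight w fun n => gammaRatio a c S n := by
  induction hS using Finset.Nonempty.cons_induction with
  | singleton l =>
    simp only [Finset.mem_singleton, forall_eq] at ha hc
    simp only [gammaRatio, Finset.prod_singleton]
    exact ⟨_, isUnitWeight_betaDensity ha hc⟩
  | cons l S hl _ ih =>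
    simp only [Finset.mem_cons, forall_eq_or_imp] at ha hc
    obtain ⟨w, hw⟩ := ih ha.2 hc.2
    simp only [gammaRatio, Finset.prod_cons]
    exact ⟨_, (isUnitWeight_betaDensity ha.1 hc.1).mulConv hw⟩

/-! ### The power series of the weight -/

/-- The inverse Mellin transform of `gammaRatio a c S` on `(0, 1]`, as the sum of its residues: the
pole at `-(a l + i)` contributes `t ^ (a l + i - 1)`. -/
noncomputable def gammaRatioDensity {ι : Type*} [DecidableEq ι] (a c : ι → ℝ) (S : Finset ι)
    (t : ℝ) : ℝ :=
  ∑ l ∈ S, t ^ (a l - 1) * ∑' i : ℕ, gammaRes a c S l i * t ^ i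

section GammaRatioDensity

open MeasureTheory Set

variable {ι : Type*} [DecidableEq ι] {a c : ι → ℝ} {S : Finset ι}

lemma continuousOn_gammaRatioDensity (hr : ∀ l ∈ S, Summable (gammaRes a c S l)) :
    ContinuousOn (gammaRatioDensity a c S) (Ioc 0 1) := by
  refine continuousOn_finsetSum _ fun l hl => ContinuousOn.mul ?_ ?_
  · exact fun x hx => (Real.continuousAt_rpow_const _ _ (Or.inl hx.1.ne')).continuousWithinAt
  · exact (continuousOn_tsum_mul_pow (hr l hl)).mono Ioc_subset_Icc_self

lemma pow_mul_gammaRatioDensity (n : ℕ) {t : ℝ} (ht : 0 < t) :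
    t ^ n * gammaRatioDensity a c S t =
      ∑ l ∈ S, t ^ (n + a l - 1) * ∑' i : ℕ, gammaRes a c S l i * t ^ i := by
  rw [gammaRatioDensity, Finset.mul_sum]
  refine Finset.sum_congr rfl fun l _ => ?_
  rw [add_sub_assoc, Real.rpow_add ht, Real.rpow_natCast, mul_assoc]

lemma integrableOn_gammaRatioDensity (ha : ∀ l ∈ S, 0 < a l)
    (hr : ∀ l ∈ S, Summable (gammaRes a c S l)) :
    IntegrableOn (gammaRatioDensity a c S) (Ioc 0 1) :=
  integrable_finsetSum _ fun l hl => integrableOn_rpow_mul_tsum (hr l hl) (ha l hl)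

lemma setIntegral_pow_mul_gammaRatioDensity (ha : ∀ l ∈ S, 0 < a l)
    (h : HasPartialFractions a S (gammaRes a c S) (gammaRatio a c S)) (n : ℕ) :
    ∫ t in Ioc (0 : ℝ) 1, t ^ n * gammaRatioDensity a c S t = gammaRatio a c S n := by
  have hna (l : ι) (hl : l ∈ S) : 0 < n + a l := add_pos_of_nonneg_of_pos n.cast_nonneg (ha l hl)
  rw [setIntegral_congr_fun measurableSet_Ioc fun t ht => pow_mul_gammaRatioDensity n ht.1,
    integral_finsetSum _ fun l hl => integrableOn_rpow_mul_tsum (h.summable hl) (hna l hl),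
    h.eq_sum fun l hl i => by
      have := ha l hl
      positivity]
  refine Finset.sum_congr rfl fun l hl => ?_
  simp only [setIntegral_rpow_mul_tsum (h.summable hl) (hna l hl), add_assoc]

theorem IsUnitWeight.eqOn_gammaRatioDensity {w : ℝ → ℝ}
    (hw : IsUnitWeight w fun n => gammaRatio a c S n) (ha : ∀ l ∈ S, 0 < a l)
    (h : HasPartialFractions a S (gammaRes a c S) (gammaRatio a c S)) :
    EqOn w (gammaRatioDensity a c S) (Ioc 0 1) := by
  have hr (l : ι) (hl : l ∈ S) := h.summable hl
  refine eqOn_Ioc_of_moments_eq (hw.continuousOn.mono Ioc_subset_Ioi_self)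
    (continuousOn_gammaRatioDensity hr) (hw.integrableOn_self.mono_set Ioc_subset_Ioi_self)
    (integrableOn_gammaRatioDensity ha hr) fun n => ?_
  rw [setIntegral_pow_mul_gammaRatioDensity ha h, hw.setIntegral_Ioc]

end GammaRatioDensity

/-! ### Gauss's multiplication formula and shifts of the Gamma function -/

section GammaMultiplication

open Real (Gamma sin pi)

lemma norm_one_sub_exp_pow {d k : ℕ} (hk : k ≤ d) :
    ‖1 - Complex.exp (2 * pi * Complex.I / d) ^ k‖ = 2 * sin (pi * (k / d)) := by
  have hexp : Complex.exp (2 * pi * Complex.I / d) ^ k =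
      Complex.exp (Complex.I * (2 * (pi * (k / d)) : ℝ)) := by
    rw [← Complex.exp_nat_mul]
    congr 1
    push_cast
    ring
  have hkd : (k : ℝ) / d ≤ 1 := div_le_one_of_le₀ (by exact_mod_cast hk) d.cast_nonneg
  have hsin : 0 ≤ sin (pi * (k / d)) := Real.sin_nonneg_of_nonneg_of_le_pi (by positivity)
    (mul_le_of_le_one_right Real.pi_pos.le hkd)
  rw [hexp, norm_sub_rev, Complex.norm_exp_I_mul_ofReal_sub_one, mul_div_cancel_left₀ _ two_ne_zero,
    Real.norm_of_nonneg (mul_nonneg zero_le_two hsin)]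

lemma prod_two_mul_sin {d : ℕ} (hd : d ≠ 0) :
    ∏ k ∈ Finset.Ico 1 d, 2 * sin (pi * (k / d)) = d := by
  obtain ⟨n, rfl⟩ := Nat.exists_eq_succ_of_ne_zero hd
  have h := (Complex.isPrimitiveRoot_exp (n + 1) hd).prod_one_sub_pow_eq_order
  calc ∏ k ∈ Finset.Ico 1 (n + 1), 2 * sin (pi * (k / (n + 1 : ℕ)))
      = ∏ k ∈ Finset.range n, ‖1 - Complex.exp (2 * pi * Complex.I / (n + 1 : ℕ)) ^ (k + 1)‖ := by
        rw [Finset.range_eq_Ico, Finset.prod_Ico_add'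
          (fun k => ‖1 - Complex.exp (2 * pi * Complex.I / (n + 1 : ℕ)) ^ k‖)]
        exact Finset.prod_congr rfl fun k hk =>
          (norm_one_sub_exp_pow (Finset.mem_Ico.1 hk).2.le).symm
    _ = (n + 1 : ℕ) := by
        rw [← norm_prod, h, ← Nat.cast_add_one, Complex.norm_natCast]

lemma prod_Ico_one_sub_div {M : Type*} [CommMonoid M] (d : ℕ) (f : ℝ → M) :
    ∏ k ∈ Finset.Ico 1 d, f (1 - k / d) = ∏ k ∈ Finset.Ico 1 d, f (k / d) := by
  have h := Finset.prod_Ico_reflect (fun k : ℕ => f (k / d)) 1 d.le_succ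
  rw [Nat.add_sub_cancel_left, Nat.add_sub_cancel] at h
  rw [← h]
  refine Finset.prod_congr rfl fun k hk => ?_
  obtain ⟨hk1, hkd⟩ := Finset.mem_Ico.1 hk
  rw [Nat.cast_sub hkd.le, sub_div, div_self (by exact_mod_cast (by omega : d ≠ 0))]

lemma prod_Gamma_div_mul_self {d : ℕ} (hd : d ≠ 0) :
    (∏ k ∈ Finset.Ico 1 d, Gamma (k / d)) * ∏ k ∈ Finset.Ico 1 d, Gamma (k / d) =
      (2 * pi) ^ (d - 1) / d := by
  have hreflection (k : ℕ) :
      Gamma (k / d) * Gamma (1 - k / d) = 2 * pi / (2 * sin (pi * (k / d))) := by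
    rw [Real.Gamma_mul_Gamma_one_sub, mul_div_mul_left _ _ two_ne_zero]
  nth_rewrite 2 [← prod_Ico_one_sub_div]
  rw [← Finset.prod_mul_distrib]
  simp only [hreflection]
  rw [Finset.prod_div_distrib, Finset.prod_const, Nat.card_Ico, prod_two_mul_sin hd]

lemma prod_Gamma_div {d : ℕ} (hd : d ≠ 0) :
    ∏ k ∈ Finset.Ico 1 d, Gamma (k / d) =
      (2 * pi) ^ (((d : ℝ) - 1) / 2) / (d : ℝ) ^ (1 / 2 : ℝ) := by
  have hd₀ : (0 : ℝ) < d := by exact_mod_cast hd.bot_lt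
  have hprod : 0 ≤ ∏ k ∈ Finset.Ico 1 d, Gamma (k / d) :=
    Finset.prod_nonneg fun k _ => Real.Gamma_nonneg_of_nonneg (by positivity)
  refine (mul_self_inj hprod (by positivity)).1 ?_
  rw [prod_Gamma_div_mul_self hd, div_mul_div_comm, ← Real.rpow_add (by positivity),
    ← Real.rpow_add hd₀, add_halves, add_halves, Real.rpow_one, ← Real.rpow_natCast,
    Nat.cast_sub (Nat.one_le_iff_ne_zero.2 hd), Nat.cast_one]

lemma ascFactorial_mul_add_one {d : ℕ} (hd : d ≠ 0) (n : ℕ) :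
    ((d * n + 1).ascFactorial d : ℝ) =
      (d : ℝ) ^ d * ∏ k ∈ Finset.Ico 1 (d + 1), (n + k / d : ℝ) := by
  have hd₀ : (d : ℝ) ≠ 0 := by exact_mod_cast hd
  have hpow : (d : ℝ) ^ d = ∏ _k ∈ Finset.Ico 1 (d + 1), (d : ℝ) := by
    rw [Finset.prod_const, Nat.card_Ico, Nat.add_sub_cancel]
  rw [hpow, ← Finset.prod_mul_distrib, Finset.prod_Ico_eq_prod_range, Nat.add_sub_cancel,
    Nat.ascFactorial_eq_prod_range, Nat.cast_prod]
  refine Finset.prod_congr rfl fun i _ => ?_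
  rw [mul_add, mul_div_cancel₀ _ hd₀]
  push_cast
  ring

theorem factorial_mul_eq_prod_Gamma {d : ℕ} (hd : d ≠ 0) (n : ℕ) :
    ((d * n)! : ℝ) = ((d : ℝ) ^ d) ^ n *
      ∏ k ∈ Finset.Ico 1 (d + 1), Gamma (n + k / d) / Gamma (k / d) := by
  have hpos (k : ℕ) (hk : k ∈ Finset.Ico 1 (d + 1)) : 0 < (k : ℝ) / d :=
    div_pos (by exact_mod_cast (Finset.mem_Ico.1 hk).1) (by exact_mod_cast hd.bot_lt)
  induction n with
  | zero =>
    rw [Finset.prod_eq_one fun k hk => by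
      rw [Nat.cast_zero, zero_add, div_self (Real.Gamma_pos_of_pos (hpos k hk)).ne']]
    simp
  | succ n ih =>
    rw [Nat.mul_succ, ← Nat.factorial_mul_ascFactorial, Nat.cast_mul, ih,
      ascFactorial_mul_add_one hd, pow_succ, mul_mul_mul_comm, ← Finset.prod_mul_distrib]
    congr 1
    refine Finset.prod_congr rfl fun k hk => ?_
    have := hpos k hk
    rw [Nat.cast_add_one, add_right_comm, Real.Gamma_add_one (by positivity)]
    ring

-- If `z` is a positive integer at most `i`, both sides are zero: `Gamma` takes the value `0` at its
-- poles, and the denominator vanishes.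
lemma Gamma_sub_natCast (z : ℝ) (i : ℕ) :
    Gamma (z - i) = (-1) ^ i * Gamma z / (ascPochhammer ℝ i).eval (1 - z) := by
  induction i with
  | zero => simp
  | succ i ih =>
    have hfactor : 1 - z + i = -(z - (i + 1)) := by ring
    rw [Nat.cast_add_one, ascPochhammer_succ_eval, hfactor]
    rcases eq_or_ne (z - (i + 1)) 0 with hpole | hz
    · rw [hpole, Real.Gamma_zero, neg_zero, mul_zero, div_zero]
    · have hstep : Gamma (z - i) = (z - (i + 1)) * Gamma (z - (i + 1)) := by
        rw [← Real.Gamma_add_one hz]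
        ring_nf
      rw [← mul_right_inj' hz, ← hstep, ih, pow_succ]
      field_simp

lemma Gamma_sub_natCast_div_Gamma_sub_natCast (x y : ℝ) (i : ℕ) :
    Gamma (x - i) / Gamma (y - i) = (ascPochhammer ℝ i).eval (1 - y) / Gamma y *
      (Gamma x / (ascPochhammer ℝ i).eval (1 - x)) := by
  have hsign : (-1 : ℝ) ^ i ≠ 0 := pow_ne_zero i (neg_ne_zero.2 one_ne_zero)
  rw [Gamma_sub_natCast, Gamma_sub_natCast, div_div_div_eq, mul_assoc,
    mul_left_comm _ ((-1 : ℝ) ^ i), mul_div_mul_left _ _ hsign]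
  ring

end GammaMultiplication

theorem gammaRes_eq {ι : Type*} [DecidableEq ι] {S : Finset ι} {l : ι} (hl : l ∈ S)
    (a c : ι → ℝ) (i : ℕ) :
    gammaRes a c S l i =
      (∏ m ∈ S, (ascPochhammer ℝ i).eval (1 - (a m + c m - a l)) / Real.Gamma (a m + c m - a l)) /
          (i ! : ℝ) *
        ∏ m ∈ S.erase l,
          Real.Gamma (a m - a l) / (ascPochhammer ℝ i).eval (1 - (a m - a l)) := by
  have hratio (m : ι) : Real.Gamma (-(a l + i) + a m) / Real.Gamma (-(a l + i) + a m + c m) =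
      (ascPochhammer ℝ i).eval (1 - (a m + c m - a l)) / Real.Gamma (a m + c m - a l) *
        (Real.Gamma (a m - a l) / (ascPochhammer ℝ i).eval (1 - (a m - a l))) := by
    rw [← Gamma_sub_natCast_div_Gamma_sub_natCast]
    ring_nf
  rw [gammaRes, gammaRatio, betaCoeff, ← Finset.mul_prod_erase S _ hl,
    Finset.prod_congr rfl fun m _ => hratio m, Finset.prod_mul_distrib, add_sub_cancel_left]
  ring

/-! ### The Gamma product of the Catalan numbers -/

/-- The shift `a_j = 1 - j/d`. With `catalanShift d` and `catalanGap d`, the product `gammaRatio`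
over `1 ≤ j < d` is `∏_j Γ(s + 1 - j/d) / Γ(s + 1 + j)`. -/
noncomputable def catalanShift (d j : ℕ) : ℝ := 1 - j / d

/-- The gap `j + j/d` between the shift `1 - j/d` and the shift `1 + j` that it is paired with. This
pairing makes all gaps larger than `1`. -/
noncomputable def catalanGap (d j : ℕ) : ℝ := j + j / d

/-- The constant `K` with `C_d(n) = K * (d ^ d) ^ (n + 1) * ∏_j Γ(n + 1 - j/d) / Γ(n + 1 + j)`. -/
noncomputable def catalanConst (d : ℕ) : ℝ :=
  (2 * Real.pi) ^ ((1 - (d : ℝ)) / 2) * (d : ℝ) ^ (1 / 2 : ℝ) *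
    (∏ p ∈ Finset.Ico 1 d, (p ! : ℝ)) / (d : ℝ) ^ d

section CatalanParameters

open Finset (Ico)
open Real (Gamma pi)

variable {d j : ℕ}

lemma catalanShift_pos (hj : j ∈ Ico 1 d) : 0 < catalanShift d j := by
  obtain ⟨hj1, hjd⟩ := Finset.mem_Ico.1 hj
  have hd : (0 : ℝ) < d := by exact_mod_cast hj1.trans hjd.le
  exact sub_pos.2 ((div_lt_one hd).2 (by exact_mod_cast hjd))

lemma one_lt_catalanGap (hj : j ∈ Ico 1 d) : 1 < catalanGap d j := by
  obtain ⟨hj1, hjd⟩ := Finset.mem_Ico.1 hj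
  have hj₁ : (1 : ℝ) ≤ j := by exact_mod_cast hj1
  have hd : (0 : ℝ) < d := by exact_mod_cast hj1.trans hjd.le
  exact lt_add_of_le_of_pos hj₁ (by positivity)

lemma catalanShift_sub (d m j : ℕ) : catalanShift d m - catalanShift d j = (j - m) / d := by
  rw [catalanShift, catalanShift]
  ring

lemma catalanShift_add_catalanGap_sub (d m j : ℕ) :
    catalanShift d m + catalanGap d m - catalanShift d j = m + j / d := by
  rw [catalanShift, catalanShift, catalanGap]
  ring

lemma natCast_sub_natCast_div_ne_intCast {m : ℕ} (hj : j ∈ Ico 1 d) (hm : m ∈ Ico 1 d)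
    (hmj : m ≠ j) (n : ℤ) : ((j : ℝ) - m) / d ≠ n := by
  rw [Finset.mem_Ico] at hj hm
  intro h
  rw [div_eq_iff (by exact_mod_cast (by omega : d ≠ 0))] at h
  have hdvd : (d : ℤ) ∣ j - m := ⟨n, by rw [mul_comm]; exact_mod_cast h⟩
  have hzero := Int.eq_zero_of_abs_lt_dvd hdvd (by rw [abs_lt]; omega)
  omega

lemma pairwise_catalanShift_sub_ne_intCast (d : ℕ) :
    (Ico 1 d : Set ℕ).Pairwise fun l m => ∀ n : ℤ, catalanShift d l - catalanShift d m ≠ n :=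
  fun l hl m hm hlm n => by
    rw [catalanShift_sub]
    exact natCast_sub_natCast_div_ne_intCast hm hl hlm n

lemma hasPartialFractions_catalan (hd : 2 ≤ d) :
    HasPartialFractions (catalanShift d) (Ico 1 d)
      (gammaRes (catalanShift d) (catalanGap d) (Ico 1 d))
      (gammaRatio (catalanShift d) (catalanGap d) (Ico 1 d)) :=
  hasPartialFractions_gammaRatio (Finset.nonempty_Ico.2 hd) (fun _ hl => one_lt_catalanGap hl)
    (pairwise_catalanShift_sub_ne_intCast d)

lemma catalanConst_pos (hd : d ≠ 0) : 0 < catalanConst d := by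
  have : 0 < ∏ p ∈ Ico 1 d, (p ! : ℝ) := Finset.prod_pos fun p _ => by positivity
  have : (0 : ℝ) < d := by exact_mod_cast hd.bot_lt
  rw [catalanConst]
  positivity

lemma inv_prod_Gamma_div (hd : d ≠ 0) :
    (∏ k ∈ Ico 1 d, Gamma (k / d))⁻¹ =
      (2 * pi) ^ ((1 - (d : ℝ)) / 2) * (d : ℝ) ^ (1 / 2 : ℝ) := by
  rw [prod_Gamma_div hd, inv_div, div_eq_mul_inv, ← Real.rpow_neg (by positivity), mul_comm]
  ring_nf

lemma gammaRatio_catalan_natCast (d n : ℕ) :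
    gammaRatio (catalanShift d) (catalanGap d) (Ico 1 d) n =
      (∏ k ∈ Ico 1 d, Gamma (n + k / d)) / ∏ p ∈ Ico 1 d, ((n + p)! : ℝ) := by
  rw [gammaRatio, Finset.prod_div_distrib, ← prod_Ico_one_sub_div d fun x => Gamma (n + x)]
  congr 1
  refine Finset.prod_congr rfl fun p _ => ?_
  rw [← Real.Gamma_nat_eq_factorial, catalanShift, catalanGap]
  push_cast
  ring_nf

theorem catalanDim_eq (hd : d ≠ 0) (n : ℕ) :
    catalanDim d n = catalanConst d * ((d : ℝ) ^ d) ^ (n + 1) *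
      gammaRatio (catalanShift d) (catalanGap d) (Ico 1 d) n := by
  have hd₀ : (d : ℝ) ≠ 0 := by exact_mod_cast hd
  have hn : (n ! : ℝ) ≠ 0 := by positivity
  rw [catalanDim, factorial_mul_eq_prod_Gamma hd, gammaRatio_catalan_natCast, catalanConst,
    ← inv_prod_Gamma_div hd, Finset.prod_Ico_succ_top (Nat.one_le_iff_ne_zero.2 hd),
    div_self hd₀, Real.Gamma_one, div_one, Real.Gamma_nat_eq_factorial, Finset.range_eq_Ico,
    Finset.prod_eq_prod_Ico_succ_bot (Nat.pos_of_ne_zero hd)]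
  simp only [Finset.prod_div_distrib, zero_add, add_zero, Nat.factorial_zero, Nat.cast_one]
  field_simp
  ring

-- In the definitions of `upperParams` and `lowerParams` the bound variable `i` is real: the list of
-- indices is `Multiset.range` cast to `Multiset ℝ`.
lemma upperParams_eq (d j : ℕ) :
    upperParams d j = (Multiset.range (d - 1)).map fun i : ℕ => -(i : ℝ) - (j : ℝ) / d := by
  simp only [upperParams, Multiset.bind_def, Multiset.pure_def, Multiset.bind_singleton,
    Multiset.map_map, Function.comp_def]

lemma lowerParams_eq (d j : ℕ) :
    lowerParams d j = ((Multiset.range (j - 1)).map fun i : ℕ => 1 - ((i : ℝ) + 1) / d) +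
      ((Multiset.range (d - j - 1)).map fun i : ℕ => 1 + ((i : ℝ) + 1) / d) := by
  simp only [lowerParams, Multiset.bind_def, Multiset.pure_def, Multiset.bind_singleton,
    Multiset.map_map, Function.comp_def]

lemma prod_erase_Ico {M : Type*} [CommMonoid M] (hj : j ∈ Ico 1 d) (f : ℕ → M) :
    ∏ m ∈ (Ico 1 d).erase j, f m = (∏ m ∈ Ico 1 j, f m) * ∏ m ∈ Ico (j + 1) d, f m := by
  rw [Finset.mem_Ico] at hj
  have hunion : (Ico 1 d).erase j = Ico 1 j ∪ Ico (j + 1) d := by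
    ext m
    simp only [Finset.mem_erase, Finset.mem_Ico, Finset.mem_union]
    omega
  have hdisj : Disjoint (Ico 1 j) (Ico (j + 1) d) :=
    Finset.disjoint_left.2 fun m => by
      simp only [Finset.mem_Ico]
      omega
  rw [hunion, Finset.prod_union hdisj]

lemma prod_Ico_natCast_sub {M : Type*} [CommMonoid M] (j : ℕ) (f : ℝ → M) :
    ∏ m ∈ Ico 1 j, f ((j : ℝ) - m) = ∏ m ∈ Ico 1 j, f m := by
  have h := Finset.prod_Ico_reflect (fun m : ℕ => f m) 1 j.le_succ
  rw [Nat.add_sub_cancel_left, Nat.add_sub_cancel] at h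
  rw [← h]
  exact Finset.prod_congr rfl fun m hm => by rw [Nat.cast_sub (Finset.mem_Ico.1 hm).2.le]

lemma prod_map_upperParams {M : Type*} [CommMonoid M] (d j : ℕ) (f : ℝ → M) :
    ((upperParams d j).map f).prod = ∏ m ∈ Ico 1 d, f (1 - (m + j / d)) := by
  rw [upperParams_eq, Multiset.map_map, Finset.prod_Ico_eq_prod_range, Finset.prod,
    Finset.range_val]
  congr 2
  funext i
  rw [Function.comp_apply]
  push_cast
  ring_nf

lemma prod_map_lowerParams {M : Type*} [CommMonoid M] (hj : j ∈ Ico 1 d) (f : ℝ → M) :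
    ((lowerParams d j).map f).prod = ∏ m ∈ (Ico 1 d).erase j, f (1 - (j - m) / d) := by
  rw [prod_erase_Ico hj, prod_Ico_natCast_sub j fun x => f (1 - x / d), lowerParams_eq,
    Multiset.map_add, Multiset.prod_add, Multiset.map_map, Multiset.map_map,
    Finset.prod_Ico_eq_prod_range, Finset.prod_Ico_eq_prod_range, Finset.prod, Finset.prod,
    Finset.range_val, Finset.range_val, Nat.sub_sub]
  congr 3 <;> funext i <;> rw [Function.comp_apply] <;> push_cast <;> ring_nf

lemma weightCoeff_eq (hj : j ∈ Ico 1 d) :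
    weightCoeff d j = catalanConst d * (d : ℝ) ^ j *
      ((∏ m ∈ Ico 1 d, Gamma (m + j / d))⁻¹ * ∏ m ∈ (Ico 1 d).erase j, Gamma ((j - m) / d)) := by
  have hd : (0 : ℝ) < d := by
    rw [Finset.mem_Ico] at hj
    exact_mod_cast (by omega : 0 < d)
  rw [weightCoeff, prod_erase_Ico hj, prod_Ico_natCast_sub j fun x => Gamma (x / d), catalanConst,
    Real.rpow_add hd, Real.rpow_sub hd, Real.rpow_natCast, Real.rpow_natCast,
    Finset.prod_div_distrib]
  ring

lemma weightCoeff_ne_zero (hj : j ∈ Ico 1 d) : weightCoeff d j ≠ 0 := by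
  have hd : d ≠ 0 := by
    rw [Finset.mem_Ico] at hj
    omega
  have hnum : ∏ m ∈ (Ico 1 d).erase j, Gamma (((j : ℝ) - m) / d) ≠ 0 :=
    Finset.prod_ne_zero_iff.2 fun m hm => Real.Gamma_ne_zero fun n => by
      obtain ⟨hmj, hm⟩ := Finset.mem_erase.1 hm
      exact_mod_cast natCast_sub_natCast_div_ne_intCast hj hm hmj (-n)
  have hden : ∏ m ∈ Ico 1 d, Gamma ((m : ℝ) + j / d) ≠ 0 :=
    Finset.prod_ne_zero_iff.2 fun m hm => by
      have hm : (0 : ℝ) < m := by exact_mod_cast (Finset.mem_Ico.1 hm).1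
      exact (Real.Gamma_pos_of_pos (by positivity)).ne'
  have hK := (catalanConst_pos hd).ne'
  rw [weightCoeff_eq hj]
  positivity

theorem weightCoeff_mul_hypTerm (hj : j ∈ Ico 1 d) (z : ℝ) (i : ℕ) :
    weightCoeff d j * hypTerm (upperParams d j) (lowerParams d j) z i =
      catalanConst d * (d : ℝ) ^ j *
        (gammaRes (catalanShift d) (catalanGap d) (Ico 1 d) j i * z ^ i) := by
  rw [hypTerm, prod_map_upperParams, prod_map_lowerParams hj, weightCoeff_eq hj, gammaRes_eq hj]
  simp only [catalanShift_sub, catalanShift_add_catalanGap_sub, Finset.prod_div_distrib]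
  ring

theorem summable_hypTerm (hj : j ∈ Ico 1 d) {t : ℝ} (ht : t ∈ Set.Icc 0 1) :
    Summable (hypTerm (upperParams d j) (lowerParams d j) t) := by
  have hd : 2 ≤ d := by
    rw [Finset.mem_Ico] at hj
    omega
  rw [← summable_mul_left_iff (weightCoeff_ne_zero hj)]
  simp only [weightCoeff_mul_hypTerm hj]
  exact (summable_mul_pow ((hasPartialFractions_catalan hd).summable hj) ht).mul_left _

end CatalanParameters

/-! ### The weights -/

/-- The hypergeometric sum `W_d`, the weight for `C_d` on `(0, d ^ d]`. -/
noncomputable def catalanWeight (d : ℕ) (x : ℝ) : ℝ :=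
  ∑ j ∈ Finset.Ico 1 d, weightCoeff d j / x ^ ((j : ℝ) / (d : ℝ)) *
    hypPFQ (upperParams d j) (lowerParams d j) (x / (d : ℝ) ^ d)

section Weights

open MeasureTheory
open Finset (Ico)
open Real (Gamma pi sqrt)
open Set (EqOn Ioc Ioi Ioo)

variable {d : ℕ} {D K R x : ℝ} {W W' w : ℝ → ℝ} {m : ℕ → ℝ}

lemma IsCatalanWeight.congr (h : IsCatalanWeight d R W) (hWW' : EqOn W W' (Ioc 0 R)) :
    IsCatalanWeight d R W' where
  continuousOn := h.continuousOn.congr hWW'.symm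
  isLUB_support := by
    have hsupp : {x | x ∈ Ioc 0 R ∧ W' x ≠ 0} = {x | x ∈ Ioc 0 R ∧ W x ≠ 0} :=
      Set.ext fun x => and_congr_right fun hx => by rw [hWW' hx]
    exact hsupp ▸ h.isLUB_support
  integrableOn n := (h.integrableOn n).congr_fun (fun x hx => by simp only [hWW' hx])
    measurableSet_Ioc
  moment n := by
    rw [← h.moment n]
    exact setIntegral_congr_fun measurableSet_Ioc fun x hx => by simp only [hWW' hx]

lemma IsUnitWeight.const_mul_comp_div_pos (hw : IsUnitWeight w m) (hK : 0 < K)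
    (hx : x ∈ Ioo 0 D) : 0 < K * w (x / D) := by
  have hD : 0 < D := hx.1.trans hx.2
  exact mul_pos hK (hw.pos (div_pos hx.1 hD) ((div_lt_one hD).2 hx.2))

theorem IsUnitWeight.isCatalanWeight (hw : IsUnitWeight w m) (hK : 0 < K) (hD : 0 < D)
    (hm : ∀ n, catalanDim d n = K * D ^ (n + 1) * m n) :
    IsCatalanWeight d D fun x => K * w (x / D) where
  continuousOn := continuousOn_const.mul
    (hw.continuousOn.comp (by fun_prop) fun x hx => Set.mem_Ioi.2 (div_pos hx.1 hD))
  isLUB_support := by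
    refine (isLUB_Ioo hD).of_subset_of_superset (isLUB_Ioc hD) ?_ ?_
    · exact fun x hx => ⟨Set.Ioo_subset_Ioc_self hx, (hw.const_mul_comp_div_pos hK hx).ne'⟩
    · exact fun x hx => hx.1
  integrableOn n := by
    simp only [mul_left_comm _ K]
    exact ((integrableOn_pow_mul_comp_div hD (hw.integrableOn n)).mono_set
      Set.Ioc_subset_Ioi_self).const_mul K
  moment n := by
    have hzero : ∀ x ∈ Ioi (0 : ℝ) \ Ioc 0 D, x ^ n * w (x / D) = 0 := fun x hx => by
      have hDx : D < x := not_le.1 fun hxD => hx.2 ⟨hx.1, hxD⟩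
      rw [hw.eq_zero ((one_le_div hD).2 hDx.le), mul_zero]
    simp only [mul_left_comm _ K]
    rw [integral_const_mul, ← setIntegral_eq_of_subset_of_forall_sdiff_eq_zero measurableSet_Ioi
      Set.Ioc_subset_Ioi_self hzero, setIntegral_pow_mul_comp_div hD, hw.moment, hm, mul_assoc]

lemma catalanWeight_eq_const_mul_gammaRatioDensity (d : ℕ) (hx : 0 < x) :
    catalanWeight d x = catalanConst d *
      gammaRatioDensity (catalanShift d) (catalanGap d) (Ico 1 d) (x / (d : ℝ) ^ d) := by
  rw [catalanWeight, gammaRatioDensity, Finset.mul_sum]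
  refine Finset.sum_congr rfl fun j hj => ?_
  have hd : (0 : ℝ) < d := by
    rw [Finset.mem_Ico] at hj
    exact_mod_cast (by omega : 0 < d)
  have hpow : ((d : ℝ) ^ d) ^ ((j : ℝ) / d) = (d : ℝ) ^ j := by
    rw [← Real.rpow_natCast, ← Real.rpow_mul hd.le, mul_div_cancel₀ _ hd.ne', Real.rpow_natCast]
  have hshift : catalanShift d j - 1 = -((j : ℝ) / d) := by
    rw [catalanShift]
    ring
  rw [div_mul_eq_mul_div, hypPFQ, ← tsum_mul_left]
  simp only [weightCoeff_mul_hypTerm hj]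
  rw [tsum_mul_left, hshift, Real.rpow_neg (by positivity), Real.div_rpow hx.le (by positivity),
    hpow, inv_div]
  ring

lemma IsUnitWeight.catalanConst_mul_comp_div (hd : 2 ≤ d)
    (hw : IsUnitWeight w fun n => gammaRatio (catalanShift d) (catalanGap d) (Ico 1 d) n)
    (hx : x ∈ Ioc 0 ((d : ℝ) ^ d)) :
    catalanConst d * w (x / (d : ℝ) ^ d) = catalanWeight d x := by
  have hD : 0 < (d : ℝ) ^ d := hx.1.trans_le hx.2
  rw [catalanWeight_eq_const_mul_gammaRatioDensity d hx.1,
    hw.eqOn_gammaRatioDensity (fun _ => catalanShift_pos) (hasPartialFractions_catalan hd)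
      ⟨div_pos hx.1 hD, (div_le_one hD).2 hx.2⟩]

lemma exists_isUnitWeight_catalan (hd : 2 ≤ d) :
    ∃ w, IsUnitWeight w fun n =>
      gammaRatio (catalanShift d) (catalanGap d) (Ico 1 d) n :=
  exists_isUnitWeight_gammaRatio (Finset.nonempty_Ico.2 hd) (fun _ => catalanShift_pos)
    fun _ => one_lt_catalanGap

theorem isCatalanWeight_catalanWeight (hd : 2 ≤ d) :
    IsCatalanWeight d ((d : ℝ) ^ d) (catalanWeight d) := by
  have hd₀ : d ≠ 0 := by omega
  obtain ⟨w, hw⟩ := exists_isUnitWeight_catalan hd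
  exact (hw.isCatalanWeight (catalanConst_pos hd₀) (by positivity) (catalanDim_eq hd₀)).congr
    fun x hx => hw.catalanConst_mul_comp_div hd hx

theorem catalanWeight_pos (hd : 2 ≤ d) (hx : x ∈ Ioo 0 ((d : ℝ) ^ d)) :
    0 < catalanWeight d x := by
  obtain ⟨w, hw⟩ := exists_isUnitWeight_catalan hd
  rw [← hw.catalanConst_mul_comp_div hd (Set.Ioo_subset_Ioc_self hx)]
  exact hw.const_mul_comp_div_pos (catalanConst_pos (by omega)) hx

theorem IsCatalanWeight.eq_catalanWeight (hd : 2 ≤ d) (h : IsCatalanWeight d R W) :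
    R = (d : ℝ) ^ d ∧ ∀ x ∈ Ioc 0 ((d : ℝ) ^ d), W x = catalanWeight d x := by
  obtain ⟨rfl, hW⟩ := h.unique (isCatalanWeight_catalanWeight hd)
  exact ⟨rfl, hW⟩

lemma catalanConst_two : catalanConst 2 = 1 / (4 * sqrt pi) := by
  have hpow : (2 * pi) ^ ((1 - ((2 : ℕ) : ℝ)) / 2) = (sqrt 2 * sqrt pi)⁻¹ := by
    rw [← Real.sqrt_mul zero_le_two, Real.sqrt_eq_rpow, ← Real.rpow_neg (by positivity)]
    norm_num
  rw [catalanConst, hpow, Nat.cast_two, ← Real.sqrt_eq_rpow, Nat.Ico_succ_singleton,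
    Finset.prod_singleton, Nat.factorial_one, Nat.cast_one]
  field_simp
  norm_num

lemma isUnitWeight_betaDensity_catalan_two :
    IsUnitWeight (betaDensity (1 / 2) (3 / 2))
      fun n => gammaRatio (catalanShift 2) (catalanGap 2) (Ico 1 2) n := by
  have hshift : catalanShift 2 1 = 1 / 2 := by norm_num [catalanShift]
  have hgap : catalanGap 2 1 = 3 / 2 := by norm_num [catalanGap]
  simp only [gammaRatio, Nat.Ico_succ_singleton, Finset.prod_singleton, hshift, hgap]
  exact isUnitWeight_betaDensity (by norm_num) (by norm_num)

lemma betaDensity_one_half_three_halves (hx : x ∈ Ioc 0 1) :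
    betaDensity (1 / 2) (3 / 2) x = 2 / sqrt pi * sqrt ((1 - x) / x) := by
  have hx₁ : 0 ≤ 1 - x := sub_nonneg.2 hx.2
  have hGamma : Gamma (3 / 2) = sqrt pi / 2 := by
    rw [show (3 : ℝ) / 2 = 1 / 2 + 1 by norm_num, Real.Gamma_add_one (by norm_num),
      Real.Gamma_one_half_eq]
    ring
  rw [betaDensity, max_eq_left hx₁, hGamma, show (1 / 2 : ℝ) - 1 = -(1 / 2) by norm_num,
    show (3 / 2 : ℝ) - 1 = 1 / 2 by norm_num, Real.rpow_neg hx.1.le, ← Real.sqrt_eq_rpow,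
    ← Real.sqrt_eq_rpow, Real.sqrt_div hx₁]
  field_simp

lemma catalanWeight_two (hx : x ∈ Ioc 0 4) :
    catalanWeight 2 x = 1 / (2 * pi) * sqrt ((4 - x) / x) := by
  have hcast : ((2 : ℕ) : ℝ) ^ 2 = 4 := by norm_num
  have hquarter : x / 4 ∈ Ioc 0 1 := ⟨by linarith [hx.1], by linarith [hx.2]⟩
  have hdiv : (1 - x / 4) / (x / 4) = (4 - x) / x := by field_simp
  rw [← isUnitWeight_betaDensity_catalan_two.catalanConst_mul_comp_div le_rfl (by rwa [hcast]),
    hcast, betaDensity_one_half_three_halves hquarter, hdiv, catalanConst_two, ← mul_assoc,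
    div_mul_div_comm, mul_assoc, Real.mul_self_sqrt Real.pi_pos.le]
  ring

lemma catalanWeight_three (x : ℝ) :
    catalanWeight 3 x =
      weightCoeff 3 1 / x ^ (1 / 3 : ℝ) * hypPFQ {-4 / 3, -1 / 3} {4 / 3} (x / 3 ^ 3) +
      weightCoeff 3 2 / x ^ (2 / 3 : ℝ) * hypPFQ {-5 / 3, -2 / 3} {2 / 3} (x / 3 ^ 3) := by
  simp only [catalanWeight, Finset.sum_Ico_eq_sum_range, Finset.sum_range_succ,
    Finset.sum_range_zero, upperParams_eq, lowerParams_eq, Multiset.range_succ, Multiset.range_zero]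
  norm_num

lemma catalanWeight_four (x : ℝ) :
    catalanWeight 4 x =
      weightCoeff 4 1 / x ^ (1 / 4 : ℝ) *
        hypPFQ {-9 / 4, -5 / 4, -1 / 4} {5 / 4, 3 / 2} (x / 4 ^ 4) +
      weightCoeff 4 2 / x ^ (1 / 2 : ℝ) *
        hypPFQ {-5 / 2, -3 / 2, -1 / 2} {3 / 4, 5 / 4} (x / 4 ^ 4) +
      weightCoeff 4 3 / x ^ (3 / 4 : ℝ) *
        hypPFQ {-11 / 4, -7 / 4, -3 / 4} {1 / 2, 3 / 4} (x / 4 ^ 4) := by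
  rw [Multiset.pair_comm (5 / 4) (3 / 2)]
  simp only [catalanWeight, Finset.sum_Ico_eq_sum_range, Finset.sum_range_succ,
    Finset.sum_range_zero, upperParams_eq, lowerParams_eq, Multiset.range_succ, Multiset.range_zero]
  norm_num

lemma catalanWeight_five (x : ℝ) :
    catalanWeight 5 x =
      weightCoeff 5 1 / x ^ (1 / 5 : ℝ) *
        hypPFQ {-16 / 5, -11 / 5, -6 / 5, -1 / 5} {6 / 5, 7 / 5, 8 / 5} (x / 5 ^ 5) +
      weightCoeff 5 2 / x ^ (2 / 5 : ℝ) *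
        hypPFQ {-17 / 5, -12 / 5, -7 / 5, -2 / 5} {4 / 5, 6 / 5, 7 / 5} (x / 5 ^ 5) +
      weightCoeff 5 3 / x ^ (3 / 5 : ℝ) *
        hypPFQ {-18 / 5, -13 / 5, -8 / 5, -3 / 5} {3 / 5, 4 / 5, 6 / 5} (x / 5 ^ 5) +
      weightCoeff 5 4 / x ^ (4 / 5 : ℝ) *
        hypPFQ {-19 / 5, -14 / 5, -9 / 5, -4 / 5} {2 / 5, 3 / 5, 4 / 5} (x / 5 ^ 5) := by
  have hreverse : ({6 / 5, 7 / 5, 8 / 5} : Multiset ℝ) = {8 / 5, 7 / 5, 6 / 5} := by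
    rw [Multiset.pair_comm, Multiset.insert_eq_cons, Multiset.insert_eq_cons,
      Multiset.cons_swap, ← Multiset.insert_eq_cons (6 / 5), Multiset.pair_comm (6 / 5)]
    rfl
  have hrotate : ({4 / 5, 6 / 5, 7 / 5} : Multiset ℝ) = {7 / 5, 4 / 5, 6 / 5} := by
    rw [Multiset.pair_comm]
    exact Multiset.cons_swap _ _ _
  rw [hreverse, hrotate]
  simp only [catalanWeight, Finset.sum_Ico_eq_sum_range, Finset.sum_range_succ,
    Finset.sum_range_zero, upperParams_eq, lowerParams_eq, Multiset.range_succ, Multiset.range_zero]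
  norm_num

end Weights

theorem mainTheorem2 :
    (∀ d : ℕ, 2 ≤ d →
      -- the hypergeometric series converge on the whole range, including the right end point
      (∀ j ∈ Finset.Ico 1 d, ∀ x ∈ Set.Ioc (0 : ℝ) ((d : ℝ) ^ d),
        Summable (hypTerm (upperParams d j) (lowerParams d j) (x / (d : ℝ) ^ d))) ∧
      -- the weight exists and is positive
      (∃ W : ℝ → ℝ, IsCatalanWeight d ((d : ℝ) ^ d) W ∧
        ∀ x ∈ Set.Ioo (0 : ℝ) ((d : ℝ) ^ d), 0 < W x) ∧
      -- the upper edge of its support is `d ^ d` and it has the hypergeometric form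
      (∀ (R : ℝ) (W : ℝ → ℝ), IsCatalanWeight d R W →
        R = (d : ℝ) ^ d ∧
        ∀ x ∈ Set.Ioc (0 : ℝ) ((d : ℝ) ^ d),
          W x = ∑ j ∈ Finset.Ico 1 d, weightCoeff d j / x ^ ((j : ℝ) / (d : ℝ)) *
            hypPFQ (upperParams d j) (lowerParams d j) (x / (d : ℝ) ^ d))) ∧
    -- the special cases `d = 2, 3, 4, 5`
    (∀ (R : ℝ) (W : ℝ → ℝ), IsCatalanWeight 2 R W → ∀ x ∈ Set.Ioc (0 : ℝ) 4,
      W x = 1 / (2 * Real.pi) * Real.sqrt ((4 - x) / x)) ∧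
    (∀ (R : ℝ) (W : ℝ → ℝ), IsCatalanWeight 3 R W → ∀ x ∈ Set.Ioc (0 : ℝ) (3 ^ 3),
      W x =
        weightCoeff 3 1 / x ^ (1 / 3 : ℝ) * hypPFQ {-4 / 3, -1 / 3} {4 / 3} (x / 3 ^ 3) +
        weightCoeff 3 2 / x ^ (2 / 3 : ℝ) * hypPFQ {-5 / 3, -2 / 3} {2 / 3} (x / 3 ^ 3)) ∧
    (∀ (R : ℝ) (W : ℝ → ℝ), IsCatalanWeight 4 R W → ∀ x ∈ Set.Ioc (0 : ℝ) (4 ^ 4),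
      W x =
        weightCoeff 4 1 / x ^ (1 / 4 : ℝ) *
          hypPFQ {-9 / 4, -5 / 4, -1 / 4} {5 / 4, 3 / 2} (x / 4 ^ 4) +
        weightCoeff 4 2 / x ^ (1 / 2 : ℝ) *
          hypPFQ {-5 / 2, -3 / 2, -1 / 2} {3 / 4, 5 / 4} (x / 4 ^ 4) +
        weightCoeff 4 3 / x ^ (3 / 4 : ℝ) *
          hypPFQ {-11 / 4, -7 / 4, -3 / 4} {1 / 2, 3 / 4} (x / 4 ^ 4)) ∧
    (∀ (R : ℝ) (W : ℝ → ℝ), IsCatalanWeight 5 R W → ∀ x ∈ Set.Ioc (0 : ℝ) (5 ^ 5),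
      W x =
        weightCoeff 5 1 / x ^ (1 / 5 : ℝ) *
          hypPFQ {-16 / 5, -11 / 5, -6 / 5, -1 / 5} {6 / 5, 7 / 5, 8 / 5} (x / 5 ^ 5) +
        weightCoeff 5 2 / x ^ (2 / 5 : ℝ) *
          hypPFQ {-17 / 5, -12 / 5, -7 / 5, -2 / 5} {4 / 5, 6 / 5, 7 / 5} (x / 5 ^ 5) +
        weightCoeff 5 3 / x ^ (3 / 5 : ℝ) *
          hypPFQ {-18 / 5, -13 / 5, -8 / 5, -3 / 5} {3 / 5, 4 / 5, 6 / 5} (x / 5 ^ 5) +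
        weightCoeff 5 4 / x ^ (4 / 5 : ℝ) *
          hypPFQ {-19 / 5, -14 / 5, -9 / 5, -4 / 5} {2 / 5, 3 / 5, 4 / 5} (x / 5 ^ 5)) := by
  refine ⟨fun d hd => ⟨fun j hj x hx => ?_, ⟨catalanWeight d, isCatalanWeight_catalanWeight hd,
      fun x hx => catalanWeight_pos hd hx⟩, fun R W h => h.eq_catalanWeight hd⟩,
    fun R W h x hx => ?_, fun R W h x hx => ?_, fun R W h x hx => ?_, fun R W h x hx => ?_⟩
  · have hD : (0 : ℝ) < (d : ℝ) ^ d := hx.1.trans_le hx.2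
    exact summable_hypTerm hj ⟨div_nonneg hx.1.le hD.le, (div_le_one hD).2 hx.2⟩
  · rw [← catalanWeight_two hx]
    exact (h.eq_catalanWeight (by norm_num)).2 x (by norm_num [hx.1, hx.2])
  · rw [← catalanWeight_three]
    exact (h.eq_catalanWeight (by norm_num)).2 x (by exact_mod_cast hx)
  · rw [← catalanWeight_four]
    exact (h.eq_catalanWeight (by norm_num)).2 x (by exact_mod_cast hx)
  · rw [← catalanWeight_five]
    exact (h.eq_catalanWeight (by norm_num)).2 x (by exact_mod_cast hx)
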